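/- **Setting.** Let $\mathbb E$ be a Euclidean space in the axiomatic sense: a set of points with distinguished subsets called straight lines and planes, a ternary relation "$B$ lies between $A$ and $C$" (which holds only for distinct points of one straight line), a congruence relation for segments and a congruence relation for angles, satisfying the axioms of Euclidean geometry: - *incidence:* each line contains at least two points; two distinct points lie on exactly one line; there are three points not on one line; three points not on one line lie on exactly one plane; each plane contains a point; a line with two distinct points on a plane lies on that plane; two planes with a common point have at least two common points; there are four points not on one plane; - *order:* if $B$ lies between $A$ and $C$, it lies between $C$ and $A$; for distinct $A,B$ there is $C$ with $B$ between $A$ and $C$; of three distinct collinear points at most one lies between the other two; Pasch's axiom (a line of the plane $ABC$ that passes through none of the non-collinear points $A,B,C$ and meets the interior of $[AB]$ meets the interior of $[AC]$ or of $[BC]$); - *congruence:* each segment is congruent to itself and, on each ray from a point $C$, there is a unique $D$ with $[AB]\cong[CD]$; congruence of segments is transitive; sums and differences of congruent segments are congruent; each angle is congruent to itself and can be laid off in a unique way from a given ray into a given half-plane; side-angle-side; - *continuity:* the axioms of Archimedes and of Cantor (nested segments on a line have a common point); - *parallels:* through a point not on a line $a$ there passes exactly one line parallel to $a$. Here $[AB]$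 consists of $A$, $B$ and all points between them. Two lines are parallel if they coincide, or if they lie on one plane and do not intersect. A vector $\overrightarrow{AB}$ is given by an initial point $A$ and an ending point $B\neq A$. A monotonic sequence of points on a line is a sequence $A_1,\dots,A_n$ ($n\ge 3$) of its points with $A_i$ between $A_{i-1}$ and $A_{i+1}$ for $1<i<n$. Two vectors $\overrightarrow{AB}$, $\overrightarrow{CD}$ lying on one straight line are *codirected*, $\overrightarrow{AB}\upuparrows\overrightarrow{CD}$, if some monotonic sequence of points on this line contains $A=A_i$, $B=A_k$, $C=A_j$, $D=A_q$ with $\operatorname{sign}(k-i)=\operatorname{sign}(q-j)$. Two vectors $\overrightarrow{AB}$, $\overrightarrow{CD}$ not lying on one straight line are *codirected* if they lie on parallel straight lines and $[BD]\cap[AC]=\varnothing$. Two vectors $\overrightarrow{AB}$, $\overrightarrow{CD}$ are *equal* if they are codirected and $[AB]\cong[CD]$. **Theorem 8.1 (with Theorem 8.2).** 1. Codirectedness of vectors in $\mathbb E$ is transitive: $\overrightarrow{AB}\upuparrows\overrightarrow{CD}$ and $\overrightarrow{CD}\upuparrows\overrightarrow{EF}$ imply $\overrightarrow{AB}\upuparrows\overrightarrow{EF}$.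 2. Equality of vectors in $\mathbb E$ is reflexive, symmetric and transitive, i.e. an equivalence relation. 3. Hence free vectors, i.e. the classes $\{\mathbf v : \mathbf v \text{ is equal to } \mathbf u\}$ of mutually equal vectors, are well defined: they form a partition of the set of all vectors, and two vectors define the same free vector if and only if they are equal. -/

import Mathlib

/-- The primitive notions of synthetic space geometry on a set of points `P`: straight lines and
planes (which are sets of points), the ternary relation of lying between, the congruence of
segments and the congruence of angles. Segments and angles are sets of points too (defined below),
so the two congruences are binary relations on sets of points; only their values on segments,
respectively on angles, are ever used. -/
structure SpaceGeometry (P : Type*) where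
  /-- `a` is a straight line -/
  IsLine : Set P → Prop
  /-- `α` is a plane -/
  IsPlane : Set P → Prop
  /-- `Btw A B C`: the point `B` lies between `A` and `C` -/
  Btw : P → P → P → Prop
  /-- congruence of segments -/
  SegCong : Set P → Set P → Prop
  /-- congruence of angles -/
  AngCong : Set P → Set P → Prop

/-- A geometric vector: a segment with distinct ending points, one of which (`tgt`) is
distinguished. -/
structure GeomVector (P : Type*) where
  /-- the starting (initial) point -/
  src : P
  /-- the ending point -/
  tgt : P
  ne : src ≠ tgt

namespace SpaceGeometry

variable {P : Type*} (G : SpaceGeometry P)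

/-- The three points lie on one straight line. -/
def Collinear3 (A B C : P) : Prop :=
  ∃ a, G.IsLine a ∧ A ∈ a ∧ B ∈ a ∧ C ∈ a

/-- The straight line `AB` (meant for `A ≠ B`). -/
def line (A B : P) : Set P := {X | G.Collinear3 A B X}

/-- The plane `ABC` (meant for `A`, `B`, `C` not on one straight line). -/
def plane (A B C : P) : Set P :=
  {X | ∃ α, G.IsPlane α ∧ A ∈ α ∧ B ∈ α ∧ C ∈ α ∧ X ∈ α}

/-- The segment `[AB]`: both ending points and all points between them. -/
def seg (A B : P) : Set P := {X | X = A ∨ X = B ∨ G.Btw A X B}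

/-- The ray `[OE⟩` coming out from `O` through `E` (meant for `O ≠ E`). -/
def ray (O E : P) : Set P := {X | X = O ∨ X = E ∨ G.Btw O X E ∨ G.Btw O E X}

/-- The open half-plane of the plane `α`, with boundary line `a`, that contains the point `N`
(meant for `N ∈ α \ a`). -/
def openHalfPlane (α a : Set P) (N : P) : Set P :=
  {X | X ∈ α ∧ X ∉ a ∧ Disjoint (G.seg X N) a}

/-- The corresponding closed half-plane. -/
def closedHalfPlane (α a : Set P) (N : P) : Set P := G.openHalfPlane α a N ∪ a

/-- The angle `∠AOB` with the vertex `O` (meant for `A`, `O`, `B` not on one straight line):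
the intersection of two closed half-planes of the plane `AOB`, the one bounded by the line `OA`
containing `B` and the one bounded by the line `OB` containing `A`. -/
def angle (A O B : P) : Set P :=
  G.closedHalfPlane (G.plane A O B) (G.line O A) B ∩
    G.closedHalfPlane (G.plane A O B) (G.line O B) A

/-- `[AB] < [CD]`: some point `E` in the interior of `[CD]` satisfies `[AB] ≅ [CE]`. -/
def SegLT (A B C D : P) : Prop :=
  ∃ E, G.Btw C E D ∧ G.SegCong (G.seg A B) (G.seg C E)

/-- Parallelism of two straight lines: they coincide, or they lie on one plane and do not
intersect. -/
def Parallel (a b : Set P) : Prop :=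
  a = b ∨ ((∃ α, G.IsPlane α ∧ a ⊆ α ∧ b ⊆ α) ∧ Disjoint a b)

/-- The axioms of Euclidean geometry in the space. -/
structure IsEuclidean : Prop where
  -- Incidence
  /-- Each straight line contains at least two points. -/
  line_two_points : ∀ a, G.IsLine a → ∃ A ∈ a, ∃ B ∈ a, A ≠ B
  /-- Through two distinct points there passes exactly one straight line. -/
  line_through : ∀ A B, A ≠ B → ∃! a, G.IsLine a ∧ A ∈ a ∧ B ∈ a
  /-- There are three points not lying on one straight line. -/
  three_points : ∃ A B C, ¬ G.Collinear3 A B C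
  /-- Through three points not on one straight line there passes exactly one plane. -/
  plane_through : ∀ A B C, ¬ G.Collinear3 A B C →
    ∃! α, G.IsPlane α ∧ A ∈ α ∧ B ∈ α ∧ C ∈ α
  /-- Each plane contains at least one point. -/
  plane_nonempty : ∀ α, G.IsPlane α → α.Nonempty
  /-- A straight line having two distinct points on a plane lies on that plane. -/
  line_subset_plane : ∀ a α, G.IsLine a → G.IsPlane α →
    ∀ A ∈ a, ∀ B ∈ a, A ≠ B → A ∈ α → B ∈ α → a ⊆ α
  /-- Two planes with a common point have at least two common points. -/
  planes_inter : ∀ α β, G.IsPlane α → G.IsPlane β → α ≠ β → (α ∩ β).Nonempty →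
    ∃ A ∈ α ∩ β, ∃ B ∈ α ∩ β, A ≠ B
  /-- There are four points not lying on one plane. -/
  four_points : ∃ A B C D, ¬ ∃ α, G.IsPlane α ∧ A ∈ α ∧ B ∈ α ∧ C ∈ α ∧ D ∈ α
  -- Order
  /-- The relation of lying between concerns three distinct points of one straight line. -/
  btw_line : ∀ A B C, G.Btw A B C → A ≠ B ∧ B ≠ C ∧ A ≠ C ∧ G.Collinear3 A B C
  /-- If `B` lies between `A` and `C`, then it lies between `C` and `A`. -/
  btw_symm : ∀ A B C, G.Btw A B C → G.Btw C B A
  /-- For distinct `A`, `B` there is a point `C` such that `B` lies between `A` and `C`. -/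
  btw_extend : ∀ A B, A ≠ B → ∃ C, G.Btw A B C
  /-- Of three distinct points on a line at most one lies between the two others. -/
  btw_unique : ∀ A B C, G.Btw A B C → ¬ G.Btw B C A ∧ ¬ G.Btw C A B
  /-- Pasch's axiom. -/
  pasch : ∀ α a A B C, G.IsPlane α → G.IsLine a → a ⊆ α → A ∈ α → B ∈ α → C ∈ α →
    ¬ G.Collinear3 A B C → A ∉ a → B ∉ a → C ∉ a → (∃ X ∈ a, G.Btw A X B) →
    (∃ X ∈ a, G.Btw A X C) ∨ (∃ X ∈ a, G.Btw B X C)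
  -- Congruence
  /-- Any segment is congruent to itself. -/
  seg_refl : ∀ A B, A ≠ B → G.SegCong (G.seg A B) (G.seg A B)
  /-- On any ray coming out from `C` there is a unique point `D` with `[AB] ≅ [CD]`. -/
  seg_layoff : ∀ A B C E, A ≠ B → C ≠ E →
    ∃! D, D ∈ G.ray C E ∧ D ≠ C ∧ G.SegCong (G.seg A B) (G.seg C D)
  /-- Congruence of segments is transitive. -/
  seg_trans : ∀ A B C D E F, A ≠ B → C ≠ D → E ≠ F → G.SegCong (G.seg A B) (G.seg C D) →
    G.SegCong (G.seg C D) (G.seg E F) → G.SegCong (G.seg A B) (G.seg E F)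
  /-- Sums of congruent segments are congruent. -/
  seg_add : ∀ A B C K L M, G.Btw A B C → G.Btw K L M →
    G.SegCong (G.seg A B) (G.seg K L) → G.SegCong (G.seg B C) (G.seg L M) →
    G.SegCong (G.seg A C) (G.seg K M)
  /-- Differences of congruent segments are congruent. -/
  seg_sub : ∀ A B C K L M, G.Btw A B C → G.Btw K L M →
    G.SegCong (G.seg A B) (G.seg K L) → G.SegCong (G.seg A C) (G.seg K M) →
    G.SegCong (G.seg B C) (G.seg L M)
  /-- Any angle is congruent to itself. -/
  ang_refl : ∀ A O B, ¬ G.Collinear3 A O B → G.AngCong (G.angle A O B) (G.angle A O B)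
  /-- For any angle `∠AOB`, any half-plane (here: of the plane `α`, bounded by the line `a`,
  containing `H`) and any ray `[QM⟩` on its boundary line there is a unique ray `n` coming out
  from `Q` within this half-plane that forms with `[QM⟩` an angle congruent to `∠AOB`. -/
  ang_layoff : ∀ A O B, ¬ G.Collinear3 A O B →
    ∀ α a H Q M, G.IsPlane α → G.IsLine a → a ⊆ α → H ∈ α → H ∉ a → Q ∈ a → M ∈ a → M ≠ Q →
    ∃! n : Set P, ∃ N ∈ G.openHalfPlane α a H,
      n = G.ray Q N ∧ G.AngCong (G.angle A O B) (G.angle M Q N)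
  /-- Side-angle-side. -/
  side_angle_side : ∀ A B C A' B' C', ¬ G.Collinear3 A B C → ¬ G.Collinear3 A' B' C' →
    G.SegCong (G.seg A B) (G.seg A' B') → G.SegCong (G.seg A C) (G.seg A' C') →
    G.AngCong (G.angle B A C) (G.angle B' A' C') →
    G.AngCong (G.angle A B C) (G.angle A' B' C') ∧ G.AngCong (G.angle A C B) (G.angle A' C' B')
  -- Continuity
  /-- Archimedes' axiom: some segment composed of `n ≥ 1` successive replicas of `[OE]` is greater
  than `[AB]`. -/
  archimedes : ∀ A B O E, A ≠ B → O ≠ E → ∃ n : ℕ, 1 ≤ n ∧ ∃ s : ℕ → P,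
    (∀ i, i + 2 ≤ n → G.Btw (s i) (s (i + 1)) (s (i + 2))) ∧
    (∀ i, i < n → s i ≠ s (i + 1) ∧ G.SegCong (G.seg O E) (G.seg (s i) (s (i + 1)))) ∧
    G.SegLT A B (s 0) (s n)
  /-- Cantor's axiom: a decreasing sequence of segments on a line has a common point. -/
  cantor : ∀ (a : Set P) (A B : ℕ → P), G.IsLine a → (∀ n, A n ∈ a ∧ B n ∈ a ∧ A n ≠ B n) →
    (∀ n, G.seg (A (n + 1)) (B (n + 1)) ⊆ G.seg (A n) (B n)) →
    ∃ X, ∀ n, X ∈ G.seg (A n) (B n)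
  -- Parallels
  /-- Through a point not on a line there passes exactly one line parallel to it. -/
  parallel_unique : ∀ a O, G.IsLine a → O ∉ a → ∃! b, G.IsLine b ∧ O ∈ b ∧ G.Parallel b a

/-- `s 0, …, s (n - 1)` is a monotonic sequence of points on the line `a`. -/
def Monotonic (a : Set P) (n : ℕ) (s : ℕ → P) : Prop :=
  3 ≤ n ∧ (∀ i, i < n → s i ∈ a) ∧ ∀ i, i + 2 < n → G.Btw (s i) (s (i + 1)) (s (i + 2))

/-- Both vectors lie on the straight line `a`. -/
def BothOn (u v : GeomVector P) (a : Set P) : Prop :=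
  G.IsLine a ∧ u.src ∈ a ∧ u.tgt ∈ a ∧ v.src ∈ a ∧ v.tgt ∈ a

/-- Codirectedness of two vectors lying on one straight line: some monotonic sequence of points
includes all their starting and ending points and both vectors have the same direction
in its numbering. -/
def CodirectedOnLine (u v : GeomVector P) : Prop :=
  ∃ a, G.BothOn u v a ∧ ∃ n s, G.Monotonic a n s ∧
    ∃ i k j q : ℕ, i < n ∧ k < n ∧ j < n ∧ q < n ∧
      s i = u.src ∧ s k = u.tgt ∧ s j = v.src ∧ s q = v.tgt ∧
      Int.sign ((k : ℤ) - i) = Int.sign ((q : ℤ) - j)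

/-- Codirectedness of two vectors not lying on one straight line: they lie on parallel lines, and
the segment connecting their ending points does not intersect the segment connecting their
initial points. -/
def CodirectedOffLine (u v : GeomVector P) : Prop :=
  (¬ ∃ a, G.BothOn u v a) ∧
  (∃ a b, G.IsLine a ∧ G.IsLine b ∧ u.src ∈ a ∧ u.tgt ∈ a ∧ v.src ∈ b ∧ v.tgt ∈ b ∧
    G.Parallel a b) ∧
  Disjoint (G.seg u.tgt v.tgt) (G.seg u.src v.src)

/-- Codirectedness of vectors in the space. -/
def Codirected (u v : GeomVector P) : Prop :=
  G.CodirectedOnLine u v ∨ G.CodirectedOffLine u v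

/-- Equality of vectors: they are codirected and the corresponding segments are congruent. -/
def VecEq (u v : GeomVector P) : Prop :=
  G.Codirected u v ∧ G.SegCong (G.seg u.src u.tgt) (G.seg v.src v.tgt)

/-- The class of all vectors equal to the vector `u`. -/
def freeVector (u : GeomVector P) : Set (GeomVector P) := {v | G.VecEq v u}

/-- Free vectors: the classes of mutually equal vectors. -/
def freeVectors : Set (Set (GeomVector P)) := Set.range G.freeVector

end SpaceGeometry

namespace SpaceGeometry

variable {P : Type*} {G : SpaceGeometry P}

/-! Codirectedness is a comparison of orientations. Pasch's axiom makes "on the same side of a line"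
an equivalence relation with at most two classes in a plane. Transported to a line, this gives a
linear order inducing betweenness, unique up to reversal. For vectors on one line, codirectedness
means that they agree with such an order or both oppose it (`codirectedOnLine_iff`).

For vectors AB, CD on distinct parallel lines, [BD] lies in the strip and can meet the transversal
AC only inside [AC]. So [BD] ∩ [AC] = ∅ says that B and D are on one side of AC
(`disjoint_seg_iff`). It follows that an order of one line determines an order of any parallel line
for which codirectedness is agreement of orders (`exists_orients_codirected_iff`).

Parallelism is transitive (`parallel_trans`), so transitivity of codirectedness asks that
transporting an order from a to c directly or through b gives the same result. One triple of vectors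
decides this. For three distinct lines, its initial points are taken on a common transversal if the
lines are coplanar; otherwise they span a plane, and being on one side of that plane is transitive
(`exists_disjoint_seg_trans`). Equality of vectors then needs only symmetry of segment congruence
(`segCong_symm`). -/

/-- The line `m` meets the interior of the segment `[AB]`. -/
def Crosses (G : SpaceGeometry P) (m : Set P) (A B : P) : Prop := ∃ X ∈ m, G.Btw A X B

namespace IsEuclidean

/-! ### Incidence -/

theorem line_eq (hG : G.IsEuclidean) {a b : Set P} {A B : P} (ha : G.IsLine a) (hb : G.IsLine b)
    (h : A ≠ B) (hAa : A ∈ a) (hBa : B ∈ a) (hAb : A ∈ b) (hBb : B ∈ b) : a = b :=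
  (hG.line_through A B h).unique ⟨ha, hAa, hBa⟩ ⟨hb, hAb, hBb⟩

theorem exists_line (hG : G.IsEuclidean) {A B : P} (h : A ≠ B) :
    ∃ a, G.IsLine a ∧ A ∈ a ∧ B ∈ a :=
  (hG.line_through A B h).exists

theorem collinear3_iff (hG : G.IsEuclidean) {a : Set P} {A B X : P} (ha : G.IsLine a)
    (h : A ≠ B) (hA : A ∈ a) (hB : B ∈ a) : G.Collinear3 A B X ↔ X ∈ a := by
  constructor
  · rintro ⟨b, hb, hAb, hBb, hX⟩
    rwa [hG.line_eq ha hb h hA hB hAb hBb]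
  · exact fun hX => ⟨a, ha, hA, hB, hX⟩

theorem eq_of_mem (hG : G.IsEuclidean) {a b : Set P} {A B C : P} (ha : G.IsLine a)
    (hb : G.IsLine b) (hAa : A ∈ a) (hAb : A ∈ b) (hBa : B ∈ a) (hBb : B ∈ b) (hCa : C ∈ a)
    (hC : C ∉ b) : A = B := by
  by_contra h
  exact hC (hG.line_eq ha hb h hAa hBa hAb hBb ▸ hCa)

theorem exists_ne_mem (hG : G.IsEuclidean) {a : Set P} (ha : G.IsLine a) (A : P) :
    ∃ B ∈ a, B ≠ A := by
  obtain ⟨B, hB, C, hC, h⟩ := hG.line_two_points a ha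
  by_cases hBA : B = A
  · exact ⟨C, hC, fun h' => h (hBA.trans h'.symm)⟩
  · exact ⟨B, hB, hBA⟩

theorem exists_notMem (hG : G.IsEuclidean) {a : Set P} (ha : G.IsLine a) : ∃ X, X ∉ a := by
  obtain ⟨A, B, C, h⟩ := hG.three_points
  by_contra! hc
  exact h ⟨a, ha, hc A, hc B, hc C⟩

theorem plane_eq_of_line (hG : G.IsEuclidean) {a α β : Set P} {X : P} (ha : G.IsLine a)
    (hα : G.IsPlane α) (hβ : G.IsPlane β) (haα : a ⊆ α) (haβ : a ⊆ β) (hX : X ∉ a)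
    (hXα : X ∈ α) (hXβ : X ∈ β) : α = β := by
  obtain ⟨A, hA, B, hB, h⟩ := hG.line_two_points a ha
  exact (hG.plane_through A B X (by rwa [hG.collinear3_iff ha h hA hB])).unique
    ⟨hα, haα hA, haα hB, hXα⟩ ⟨hβ, haβ hA, haβ hB, hXβ⟩

theorem exists_plane_of_line (hG : G.IsEuclidean) {a : Set P} {X : P} (ha : G.IsLine a)
    (hX : X ∉ a) : ∃ α, G.IsPlane α ∧ a ⊆ α ∧ X ∈ α := by
  obtain ⟨A, hA, B, hB, h⟩ := hG.line_two_points a ha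
  obtain ⟨α, hα, hAα, hBα, hXα⟩ :=
    (hG.plane_through A B X (by rwa [hG.collinear3_iff ha h hA hB])).exists
  exact ⟨α, hα, hG.line_subset_plane a α ha hα A hA B hB h hAα hBα, hXα⟩

theorem exists_line_of_planes (hG : G.IsEuclidean) {α β : Set P} {X : P} (hα : G.IsPlane α)
    (hβ : G.IsPlane β) (h : α ≠ β) (hXα : X ∈ α) (hXβ : X ∈ β) :
    ∃ a, G.IsLine a ∧ X ∈ a ∧ α ∩ β = a := by
  obtain ⟨A, hA, B, hB, hAB⟩ := hG.planes_inter α β hα hβ h ⟨X, hXα, hXβ⟩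
  obtain ⟨a, ha, hAa, hBa⟩ := hG.exists_line hAB
  have haα := hG.line_subset_plane a α ha hα A hAa B hBa hAB hA.1 hB.1
  have haβ := hG.line_subset_plane a β ha hβ A hAa B hBa hAB hA.2 hB.2
  have key : α ∩ β = a := by
    refine Set.Subset.antisymm (fun Y hY => ?_) (Set.subset_inter haα haβ)
    by_contra hYa
    exact h (hG.plane_eq_of_line ha hα hβ haα haβ hYa hY.1 hY.2)
  exact ⟨a, ha, key ▸ ⟨hXα, hXβ⟩, key⟩

/-! ### Betweenness and separation of a plane by a line -/

theorem btw_comm (hG : G.IsEuclidean) {A B C : P} : G.Btw A B C ↔ G.Btw C B A :=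
  ⟨hG.btw_symm _ _ _, hG.btw_symm _ _ _⟩

theorem mem_of_btw (hG : G.IsEuclidean) {a : Set P} {A B C : P} (ha : G.IsLine a)
    (h : G.Btw A B C) (hA : A ∈ a) (hC : C ∈ a) : B ∈ a := by
  obtain ⟨-, -, h3, b, hb, hAb, hBb, hCb⟩ := hG.btw_line A B C h
  rwa [hG.line_eq ha hb h3 hA hC hAb hCb]

theorem mem_of_btw' (hG : G.IsEuclidean) {a : Set P} {A B C : P} (ha : G.IsLine a)
    (h : G.Btw A B C) (hA : A ∈ a) (hB : B ∈ a) : C ∈ a := by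
  obtain ⟨h1, -, -, b, hb, hAb, hBb, hCb⟩ := hG.btw_line A B C h
  rwa [hG.line_eq ha hb h1 hA hB hAb hBb]

theorem mem_of_btw'' (hG : G.IsEuclidean) {a : Set P} {A B C : P} (ha : G.IsLine a)
    (h : G.Btw A B C) (hB : B ∈ a) (hC : C ∈ a) : A ∈ a :=
  hG.mem_of_btw' ha (hG.btw_symm _ _ _ h) hC hB

theorem crosses_comm (hG : G.IsEuclidean) {m : Set P} {A B : P} :
    G.Crosses m A B ↔ G.Crosses m B A := by
  simp only [Crosses, hG.btw_comm (A := A)]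

theorem not_crosses_self (hG : G.IsEuclidean) {m : Set P} {A : P} : ¬ G.Crosses m A A :=
  fun ⟨X, _, h⟩ => (hG.btw_line A X A h).2.2.1 rfl

theorem seg_comm (hG : G.IsEuclidean) (A B : P) : G.seg A B = G.seg B A := by
  ext X
  simp only [seg, Set.mem_ofPred_eq, hG.btw_comm (A := A)]
  tauto

/-- A point `E` on the extension of the segment from a point `D` of the line `m` to a point `A`
off it lies on the same side of `m` as `A`. -/
theorem not_crosses_of_btw (hG : G.IsEuclidean) {m : Set P} {D A E : P} (hm : G.IsLine m)
    (hD : D ∈ m) (hA : A ∉ m) (h : G.Btw D A E) : E ∉ m ∧ ¬ G.Crosses m A E := by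
  have hE : E ∉ m := fun hE => hA (hG.mem_of_btw hm h hD hE)
  refine ⟨hE, fun ⟨X, hX, hXb⟩ => ?_⟩
  obtain ⟨-, -, -, b, hb, hDb, hAb, hEb⟩ := hG.btw_line _ _ _ h
  have : X = D := hG.eq_of_mem hb hm (hG.mem_of_btw hb hXb hAb hEb) hX hDb hD hAb hA
  subst this
  exact (hG.btw_unique _ _ _ hXb).2 (hG.btw_symm _ _ _ h)

theorem crosses_trans_of_not_collinear (hG : G.IsEuclidean) {α m : Set P} {A B C : P}
    (hα : G.IsPlane α) (hm : G.IsLine m) (hmα : m ⊆ α) (hA : A ∈ α) (hB : B ∈ α) (hC : C ∈ α)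
    (hAm : A ∉ m) (hBm : B ∉ m) (hCm : C ∉ m) (hABC : ¬ G.Collinear3 A B C)
    (h1 : ¬ G.Crosses m A B) (h2 : ¬ G.Crosses m B C) : ¬ G.Crosses m A C := by
  intro h
  rcases hG.pasch α m A C B hα hm hmα hA hC hB
    (fun ⟨a, h, h1, h2, h3⟩ => hABC ⟨a, h, h1, h3, h2⟩) hAm hCm hBm h with h | h
  · exact h1 h
  · exact h2 (hG.crosses_comm.1 h)

/-- A point off the line `l`, on the same side of `m` as `A`. -/
theorem exists_same_side (hG : G.IsEuclidean) {α m l : Set P} {A O : P}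
    (hα : G.IsPlane α) (hm : G.IsLine m) (hmα : m ⊆ α) (hA : A ∈ α) (hAm : A ∉ m)
    (hl : G.IsLine l) (hAl : A ∈ l) (hOl : O ∈ l) (hOm : O ∈ m) :
    ∃ E ∈ α, E ∉ m ∧ E ∉ l ∧ ¬ G.Crosses m A E := by
  -- Since `D ≠ O`, the point `D` of `m` is off `l`. Extending `[DA]` beyond `A` therefore leaves
  -- `l` without crossing `m`.
  obtain ⟨D, hDm, hDO⟩ := hG.exists_ne_mem hm O
  have hDl : D ∉ l := fun h => hDO (hG.eq_of_mem hl hm h hDm hOl hOm hAl hAm)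
  have hDA : D ≠ A := fun h => hAm (h ▸ hDm)
  obtain ⟨E, hE⟩ := hG.btw_extend D A hDA
  obtain ⟨h1, h2⟩ := hG.not_crosses_of_btw hm hDm hAm hE
  obtain ⟨b, hb, hDb, hAb⟩ := hG.exists_line hDA
  refine ⟨E, ?_, h1, fun h => hDl (hG.mem_of_btw'' hl hE hAl h), h2⟩
  exact hG.line_subset_plane b α hb hα D hDb A hAb hDA (hmα hDm) hA (hG.mem_of_btw' hb hE hDb hAb)

/-- Pasch handles a genuine triangle. If the points lie on a line `l`, an auxiliary `E` off `l`, on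
the side of `A`, makes every triangle used nondegenerate: `E` is on the side of `B`, then of `C`,
and triangle `AEC` concludes. -/
theorem crosses_trans (hG : G.IsEuclidean) {α m : Set P} {A B C : P}
    (hα : G.IsPlane α) (hm : G.IsLine m) (hmα : m ⊆ α) (hA : A ∈ α) (hB : B ∈ α) (hC : C ∈ α)
    (hAm : A ∉ m) (hBm : B ∉ m) (hCm : C ∉ m)
    (h1 : ¬ G.Crosses m A B) (h2 : ¬ G.Crosses m B C) : ¬ G.Crosses m A C := by
  by_cases hABC : G.Collinear3 A B C
  · rintro ⟨O, hOm, hO⟩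
    obtain ⟨l, hl, hAl, hBl, hCl⟩ := hABC
    obtain ⟨E, hE, hEm, hEl, hAE⟩ := hG.exists_same_side hα hm hmα hA hAm hl hAl
      (hG.mem_of_btw hl hO hAl hCl) hOm
    have key : ∀ X Y, X ∈ l → Y ∈ l → X ∈ α → Y ∈ α → X ∉ m → Y ∉ m → ¬ G.Crosses m X Y →
        ¬ G.Crosses m X E → ¬ G.Crosses m Y E := by
      intro X Y hX hY hXα hYα hXm hYm hXY hXE
      rcases eq_or_ne X Y with rfl | hne
      · exact hXE
      refine hG.crosses_trans_of_not_collinear hα hm hmα hYα hXα hE hYm hXm hEm ?_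
        (fun h => hXY (hG.crosses_comm.1 h)) hXE
      rwa [hG.collinear3_iff hl hne.symm hY hX]
    have hCE := key B C hBl hCl hB hC hBm hCm h2 (key A B hAl hBl hA hB hAm hBm h1 hAE)
    refine hG.crosses_trans_of_not_collinear hα hm hmα hA hE hC hAm hEm hCm ?_ hAE
      (fun h => hCE (hG.crosses_comm.1 h)) ⟨O, hOm, hO⟩
    rintro ⟨k, hk, hAk, hEk, hCk⟩
    exact hEl (hG.line_eq hl hk (hG.btw_line _ _ _ hO).2.2.1 hAl hCl hAk hCk ▸ hEk)
  · exact hG.crosses_trans_of_not_collinear hα hm hmα hA hB hC hAm hBm hCm hABC h1 h2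

/-- Pasch's axiom in the plane of the triangle. -/
theorem pasch_of_mem (hG : G.IsEuclidean) {m : Set P} {A B C X Y : P} (hm : G.IsLine m)
    (h : ¬ G.Collinear3 A B C) (hA : A ∉ m) (hB : B ∉ m) (hC : C ∉ m) (hX : X ∈ m)
    (hXb : G.Btw A X B) (hXY : X ≠ Y) (hY : Y ∈ m)
    (hYp : ∀ α, G.IsPlane α → A ∈ α → B ∈ α → C ∈ α → Y ∈ α) :
    G.Crosses m A C ∨ G.Crosses m B C := by
  obtain ⟨α, hα, hAα, hBα, hCα⟩ := (hG.plane_through A B C h).exists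
  obtain ⟨b, hb, hAb, hBb⟩ := hG.exists_line (hG.btw_line _ _ _ hXb).2.2.1
  have hXα := hG.line_subset_plane b α hb hα A hAb B hBb (hG.btw_line _ _ _ hXb).2.2.1 hAα hBα
    (hG.mem_of_btw hb hXb hAb hBb)
  exact hG.pasch α m A B C hα hm (hG.line_subset_plane m α hm hα X hX Y hY hXY hXα
    (hYp α hα hAα hBα hCα)) hAα hBα hCα h hA hB hC ⟨X, hX, hXb⟩

theorem btw_mem_plane (hG : G.IsEuclidean) {α : Set P} {A B C : P} (hα : G.IsPlane α)
    (h : G.Btw A B C) (hA : A ∈ α) (hC : C ∈ α) : B ∈ α := by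
  obtain ⟨-, -, h3, b, hb, hAb, hBb, hCb⟩ := hG.btw_line A B C h
  exact hG.line_subset_plane b α hb hα A hAb C hCb h3 hA hC hBb

theorem btw_mem_plane' (hG : G.IsEuclidean) {α : Set P} {A B C : P} (hα : G.IsPlane α)
    (h : G.Btw A B C) (hA : A ∈ α) (hB : B ∈ α) : C ∈ α := by
  obtain ⟨h1, -, -, b, hb, hAb, hBb, hCb⟩ := hG.btw_line A B C h
  exact hG.line_subset_plane b α hb hα A hAb B hBb h1 hA hB hCb

/-- Of three distinct points of a line at least one lies between the two others. -/
theorem btw_total (hG : G.IsEuclidean) {a : Set P} {A B C : P} (ha : G.IsLine a) (hA : A ∈ a)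
    (hB : B ∈ a) (hC : C ∈ a) (hAB : A ≠ B) (hBC : B ≠ C) (hAC : A ≠ C) :
    G.Btw A B C ∨ G.Btw B A C ∨ G.Btw A C B := by
  by_contra! hcon
  obtain ⟨h1, h2, h3⟩ := hcon
  obtain ⟨D, hD⟩ := hG.exists_notMem ha
  have hBD : B ≠ D := fun h => hD (h ▸ hB)
  obtain ⟨E, hE⟩ := hG.btw_extend B D hBD
  obtain ⟨g, hg, hBg, hDg⟩ := hG.exists_line hBD
  have hEg := hG.mem_of_btw' hg hE hBg hDg
  have hEa : E ∉ a := fun h => hD (hG.mem_of_btw ha hE hB h)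
  -- Pasch in triangle `BEY`: the line `XD` enters at `D`, and could leave through `[BY]` only at
  -- `X`, which is excluded, so it leaves through `[EY]`.
  have haux : ∀ X Y, X ∈ a → Y ∈ a → X ≠ B → Y ≠ B → X ≠ Y → ¬ G.Btw B X Y → ∀ m, G.IsLine m →
      X ∈ m → D ∈ m → ∃ Z ∈ m, G.Btw E Z Y := by
    intro X Y hX hY hXB hYB hXY hn m hm hXm hDm
    have hBm : B ∉ m := fun h => hD (hG.line_eq hm ha hXB hXm h hX hB ▸ hDm)
    have hYm : Y ∉ m := fun h => hD (hG.line_eq hm ha hXY hXm h hX hY ▸ hDm)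
    have hEm : E ∉ m := fun h => hBm (hG.mem_of_btw'' hm hE hDm h)
    have hXD : X ≠ D := fun h => hD (h ▸ hX)
    obtain ⟨b, hb, hBb, hYb⟩ := hG.exists_line hYB.symm
    have hnc : ¬ G.Collinear3 B E Y := by
      rintro ⟨c, hc, hBc, hEc, hYc⟩
      exact hEa (hG.line_eq hc ha hYB hYc hBc hY hB ▸ hEc)
    rcases hG.pasch_of_mem hm (X := D) (Y := X) hnc hBm hEm hYm hDm hE
      hXD.symm hXm (fun α hα h1 _ h3 =>
        hG.line_subset_plane a α ha hα B hB Y hY hYB.symm h1 h3 hX) with ⟨Z, hZ, hZb⟩ | h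
    · have : Z = X := hG.eq_of_mem ha hm (hG.mem_of_btw ha hZb hB hY) hZ hX hXm hB hBm
      exact absurd (this ▸ hZb) hn
    · exact h
  have hAD : A ≠ D := fun h => hD (h ▸ hA)
  have hCD : C ≠ D := fun h => hD (h ▸ hC)
  obtain ⟨m, hm, hAm, hDm⟩ := hG.exists_line hAD
  obtain ⟨k, hk, hCk, hDk⟩ := hG.exists_line hCD
  obtain ⟨Z, hZm, hZ⟩ := haux A C hA hC hAB hBC.symm hAC h2 m hm hAm hDm
  obtain ⟨W, hWk, hW⟩ := haux C A hC hA hBC.symm hAB hAC.symm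
    (fun h => h3 (hG.btw_symm _ _ _ h)) k hk hCk hDk
  have hmC : C ∉ m := fun h => hD (hG.line_eq hm ha hAC hAm h hA hC ▸ hDm)
  have hmB : B ∉ m := fun h => hD (hG.line_eq hm ha hAB hAm h hA hB ▸ hDm)
  have hkA : A ∉ k := fun h => hD (hG.line_eq hk ha hAC h hCk hA hC ▸ hDk)
  have hgA : A ∉ g := fun h => hD (hG.line_eq hg ha hAB h hBg hA hB ▸ hDg)
  have hgC : C ∉ g := fun h => hD (hG.line_eq hg ha hBC hBg h hB hC ▸ hDg)
  have hEm : E ∉ m := fun h => hmB (hG.mem_of_btw'' hm hE hDm h)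
  have hZne := hG.btw_line _ _ _ hZ
  have hWne := hG.btw_line _ _ _ hW
  have hEA : E ≠ A := hWne.2.2.1
  have hEC : E ≠ C := hZne.2.2.1
  obtain ⟨p, hp, hEp, hCp⟩ := hG.exists_line hEC
  have hZp := hG.mem_of_btw hp hZ hEp hCp
  have hZk : Z ∉ k := fun h => by
    have : p = k := hG.line_eq hp hk hZne.2.1 hZp hCp h hCk
    have h4 : p = g := hG.line_eq hp hg (hG.btw_line _ _ _ hE).2.1 (this ▸ hDk) hEp hDg hEg
    exact hgC (h4 ▸ hCp)
  have hEk : E ∉ k := fun h => hgC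
    (hG.line_eq hk hg (hG.btw_line _ _ _ hE).2.1 hDk h hDg hEg ▸ hCk)
  have hAZ : A ≠ Z := fun h => hEa
    (hG.line_eq hp ha hAC (h ▸ hZp) hCp hA hC ▸ hEp)
  -- Pasch in triangle `EAZ`: the line `CD` enters at `W` and would meet the line `EZ` at `C`, which
  -- is beyond `Z`. So it leaves through `[AZ]`, at `D`.
  have hADZ : G.Btw A D Z := by
    have hnc : ¬ G.Collinear3 E A Z := by
      rintro ⟨c, hc, hEc, hAc, hZc⟩
      exact hEm (hG.line_eq hc hm hAZ hAc hZc hAm hZm ▸ hEc)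
    have hWC : W ≠ C := by
      rintro rfl
      exact hEa (hG.mem_of_btw'' ha hW hC hA)
    rcases hG.pasch_of_mem hk (X := W) (Y := C) hnc hEk hkA hZk hWk hW
      hWC hCk (fun α hα h1 h2 h3 => hG.btw_mem_plane' hα hZ h1 h3) with ⟨V, hV, hVb⟩ | ⟨V, hV, hVb⟩
    · have hVC : V = C := hG.eq_of_mem hp hk (hG.mem_of_btw hp hVb hEp hZp) hV hCp hCk hEp hEk
      subst hVC
      exact absurd (hG.btw_symm _ _ _ hVb) (hG.btw_unique _ _ _ hZ).1
    · have : V = D := hG.eq_of_mem hm hk (hG.mem_of_btw hm hVb hAm hZm) hV hDm hDk hAm hkA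
      exact this ▸ hVb
  have hZg : Z ∉ g := fun h => hgC (hG.mem_of_btw' hg hZ hEg h)
  have hnc : ¬ G.Collinear3 A Z C := by
    rintro ⟨c, hc, hAc, hZc, hCc⟩
    exact hmC (hG.line_eq hc hm hAZ hAc hZc hAm hZm ▸ hCc)
  -- Pasch in triangle `AZC`: the line `BD` enters at `D` and must leave at `B` between `A` and `C`,
  -- or at `E` between `Z` and `C`. Both are excluded.
  rcases hG.pasch_of_mem hg (X := D) (Y := B) hnc hgA hZg hgC hDg hADZ
      hBD.symm hBg (fun α hα h1 h2 h3 => hG.line_subset_plane a α ha hα A hA C hC hAC h1 h3 hB)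
      with ⟨V, hV, hVb⟩ | ⟨V, hV, hVb⟩
  · have : V = B := hG.eq_of_mem ha hg (hG.mem_of_btw ha hVb hA hC) hV hB hBg hA hgA
    exact h1 (this ▸ hVb)
  · have : V = E := hG.eq_of_mem hp hg (hG.mem_of_btw hp hVb hZp hCp) hV hEp hEg hZp hZg
    subst this
    exact (hG.btw_unique _ _ _ hVb).2 (hG.btw_symm _ _ _ hZ)

/-- A line does not meet the interiors of all three sides of a triangle. -/
theorem not_btw_of_triangle (hG : G.IsEuclidean) {A B C D E F : P} (h : ¬ G.Collinear3 A B C)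
    (hD : G.Btw A D B) (hE : G.Btw B E C) (hF : G.Btw A F C) : ¬ G.Btw D E F := by
  intro hDEF
  obtain ⟨p, hp, hAp, hBp⟩ := hG.exists_line (hG.btw_line _ _ _ hD).2.2.1
  obtain ⟨q, hq, hBq, hCq⟩ := hG.exists_line (hG.btw_line _ _ _ hE).2.2.1
  obtain ⟨r, hr, hAr, hCr⟩ := hG.exists_line (hG.btw_line _ _ _ hF).2.2.1
  have hpC : C ∉ p := fun hC => h ⟨p, hp, hAp, hBp, hC⟩
  have hqA : A ∉ q := fun hA => h ⟨q, hq, hA, hBq, hCq⟩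
  have hDp := hG.mem_of_btw hp hD hAp hBp
  have hEq := hG.mem_of_btw hq hE hBq hCq
  have hFr := hG.mem_of_btw hr hF hAr hCr
  have hDq : D ∉ q := fun h => hqA (hG.mem_of_btw'' hq hD h hBq)
  have hFq : F ∉ q := fun h => hqA (hG.mem_of_btw'' hq hF h hCq)
  have hnc : ¬ G.Collinear3 D F A := by
    rintro ⟨c, hc, hDc, hFc, hAc⟩
    have : c = p := hG.line_eq hc hp (hG.btw_line _ _ _ hD).1 hAc hDc hAp hDp
    subst this
    exact hpC (hG.mem_of_btw' hc hF hAc hFc)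
  -- In triangle `DFA` the line `BC` enters at `E`, so it would leave at `B` inside `[DA]` or at `C`
  -- inside `[FA]`; but these points lie beyond `D` and `F`.
  rcases hG.pasch_of_mem hq (X := E) (Y := B) hnc hDq hFq hqA hEq hDEF
    (hG.btw_line _ _ _ hE).1.symm hBq (fun α hα h1 _ h3 => hG.btw_mem_plane' hα hD h3 h1)
    with ⟨V, hV, hVb⟩ | ⟨V, hV, hVb⟩
  · have : V = B := hG.eq_of_mem hp hq (hG.mem_of_btw hp hVb hDp hAp) hV hBp hBq hAp hqA
    subst this
    exact (hG.btw_unique _ _ _ hD).1 hVb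
  · have : V = C := hG.eq_of_mem hr hq (hG.mem_of_btw hr hVb hFr hAr) hV hCr hCq hAr hqA
    subst this
    exact (hG.btw_unique _ _ _ hF).1 hVb

/-- Three crossing points would be distinct points of `m`, so one would lie between the others by
`btw_total`; `not_btw_of_triangle` rules out each choice. -/
theorem not_crosses_of_crosses_of_not_collinear (hG : G.IsEuclidean) {m : Set P} {A B C : P}
    (hm : G.IsLine m) (h : ¬ G.Collinear3 A B C) (h1 : G.Crosses m A B) (h2 : G.Crosses m B C) :
    ¬ G.Crosses m A C := by
  rintro ⟨F, hFm, hF⟩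
  obtain ⟨D, hDm, hD⟩ := h1
  obtain ⟨E, hEm, hE⟩ := h2
  obtain ⟨p, hp, hAp, hBp⟩ := hG.exists_line (hG.btw_line _ _ _ hD).2.2.1
  obtain ⟨q, hq, hBq, hCq⟩ := hG.exists_line (hG.btw_line _ _ _ hE).2.2.1
  have hpC : C ∉ p := fun hC => h ⟨p, hp, hAp, hBp, hC⟩
  have hqA : A ∉ q := fun hA => h ⟨q, hq, hA, hBq, hCq⟩
  have hDp := hG.mem_of_btw hp hD hAp hBp
  have hEq := hG.mem_of_btw hq hE hBq hCq
  have hDE : D ≠ E := by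
    rintro rfl
    exact hqA (hG.mem_of_btw'' hq hD hEq hBq)
  have hDF : D ≠ F := by
    rintro rfl
    exact hpC (hG.mem_of_btw' hp hF hAp hDp)
  have hEF : E ≠ F := by
    rintro rfl
    exact hqA (hG.mem_of_btw'' hq hF hEq hCq)
  have s := hG.btw_symm
  rcases hG.btw_total hm hDm hEm hFm hDE hEF hDF with h' | h' | h'
  · exact hG.not_btw_of_triangle h hD hE hF h'
  · exact hG.not_btw_of_triangle (fun ⟨a, ha, h1, h2, h3⟩ => h ⟨a, ha, h3, h2, h1⟩)
      (s _ _ _ hE) (s _ _ _ hD) (s _ _ _ hF) h'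
  · exact hG.not_btw_of_triangle (fun ⟨a, ha, h1, h2, h3⟩ => h ⟨a, ha, h2, h1, h3⟩)
      (s _ _ _ hD) hF hE h'

/-- This bounds the number of sides by two. In the collinear case a point `E` off the line, on the
side of `A`, is opposite to `B`. Triangle `CBE` then puts `C` on the side of `E`. -/
theorem not_crosses_of_crosses (hG : G.IsEuclidean) {α m : Set P} {A B C : P}
    (hα : G.IsPlane α) (hm : G.IsLine m) (hmα : m ⊆ α) (hA : A ∈ α) (hB : B ∈ α) (hC : C ∈ α)
    (hAm : A ∉ m) (hBm : B ∉ m) (hCm : C ∉ m)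
    (h1 : G.Crosses m A B) (h2 : G.Crosses m B C) : ¬ G.Crosses m A C := by
  by_cases hABC : G.Collinear3 A B C
  · obtain ⟨l, hl, hAl, hBl, hCl⟩ := hABC
    obtain ⟨O, hOm, hO⟩ := h1
    obtain ⟨E, hE, hEm, hEl, hAE⟩ := hG.exists_same_side hα hm hmα hA hAm hl hAl
      (hG.mem_of_btw hl hO hAl hBl) hOm
    have hBE : G.Crosses m B E := by
      by_contra hBE
      exact hG.crosses_trans hα hm hmα hA hE hB hAm hEm hBm hAE
        (fun h => hBE (hG.crosses_comm.1 h)) ⟨O, hOm, hO⟩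
    have hBC : B ≠ C := by
      rintro rfl
      exact hG.not_crosses_self h2
    have hCE : ¬ G.Crosses m C E :=
      hG.not_crosses_of_crosses_of_not_collinear hm
        (by rwa [hG.collinear3_iff hl hBC.symm hCl hBl]) (hG.crosses_comm.1 h2) hBE
    exact hG.crosses_trans hα hm hmα hA hE hC hAm hEm hCm hAE
      (fun h => hCE (hG.crosses_comm.1 h))
  · exact hG.not_crosses_of_crosses_of_not_collinear hm hABC h1 h2

end IsEuclidean


/-- `r` is a linear order of the line `a` that induces the betweenness on it. -/
structure Orients (G : SpaceGeometry P) (a : Set P) (r : P → P → Prop) : Prop where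
  irrefl : ∀ A ∈ a, ¬ r A A
  trans : ∀ A ∈ a, ∀ B ∈ a, ∀ C ∈ a, r A B → r B C → r A C
  total : ∀ A ∈ a, ∀ B ∈ a, A ≠ B → r A B ∨ r B A
  btw : ∀ A ∈ a, ∀ B ∈ a, ∀ C ∈ a, G.Btw A B C ↔ r A B ∧ r B C ∨ r C B ∧ r B A

namespace Orients

theorem symm {a : Set P} {r : P → P → Prop} (h : G.Orients a r) :
    G.Orients a (fun A B => r B A) where
  irrefl := h.irrefl
  trans A hA B hB C hC h1 h2 := h.trans C hC B hB A hA h2 h1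
  total A hA B hB hne := (h.total A hA B hB hne).symm
  btw A hA B hB C hC := by
    rw [h.btw A hA B hB C hC]
    tauto

theorem asymm {a : Set P} {r : P → P → Prop} (h : G.Orients a r) {A B : P} (hA : A ∈ a)
    (hB : B ∈ a) (hAB : r A B) : ¬ r B A :=
  fun h' => h.irrefl A hA (h.trans A hA B hB A hA hAB h')

theorem ne {a : Set P} {r : P → P → Prop} (h : G.Orients a r) {A B : P} (hA : A ∈ a)
    (hAB : r A B) : A ≠ B := by
  rintro rfl
  exact h.irrefl A hA hAB

theorem not_iff {a : Set P} {r : P → P → Prop} (h : G.Orients a r) {A B : P} (hA : A ∈ a)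
    (hB : B ∈ a) (hAB : A ≠ B) : ¬ r A B ↔ r B A :=
  ⟨(h.total A hA B hB hAB).resolve_left, fun h1 h2 => h.asymm hA hB h2 h1⟩

end Orients

namespace IsEuclidean

/-! ### Orientations of a line -/

/-- On a line `m` through `O` other than `a`, separation by `O` becomes separation by `m`. The
formula encodes that there are at most two sides. -/
theorem btw_iff_btw_iff (hG : G.IsEuclidean) {a : Set P} {O A B C : P} (ha : G.IsLine a)
    (hO : O ∈ a) (hA : A ∈ a) (hB : B ∈ a) (hC : C ∈ a) (hAO : A ≠ O) (hBO : B ≠ O)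
    (hCO : C ≠ O) : (G.Btw A O C ↔ G.Btw B O C) ↔ ¬ G.Btw A O B := by
  obtain ⟨H, hH⟩ := hG.exists_notMem ha
  obtain ⟨α, hα, haα, hHα⟩ := hG.exists_plane_of_line ha hH
  have hOH : O ≠ H := fun h => hH (h ▸ hO)
  obtain ⟨m, hm, hOm, hHm⟩ := hG.exists_line hOH
  have hmα := hG.line_subset_plane m α hm hα O hOm H hHm hOH (haα hO) hHα
  have hnot : ∀ X ∈ a, X ≠ O → X ∉ m := fun X hX hXO hXm =>
    hXO (hG.eq_of_mem hm ha hXm hX hOm hO hHm hH)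
  have hcr : ∀ X ∈ a, ∀ Y ∈ a, X ≠ O → (G.Btw X O Y ↔ G.Crosses m X Y) := by
    intro X hX Y hY hXO
    refine ⟨fun h => ⟨O, hOm, h⟩, fun ⟨Z, hZm, hZ⟩ => ?_⟩
    have : Z = O := hG.eq_of_mem ha hm (hG.mem_of_btw ha hZ hX hY) hZm hO hOm hX (hnot X hX hXO)
    exact this ▸ hZ
  rw [hcr A hA C hC hAO, hcr B hB C hC hBO, hcr A hA B hB hAO]
  have hAm := hnot A hA hAO
  have hBm := hnot B hB hBO
  have hCm := hnot C hC hCO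
  have t1 := hG.crosses_trans hα hm hmα (haα hA) (haα hB) (haα hC) hAm hBm hCm
  have t2 := hG.crosses_trans hα hm hmα (haα hB) (haα hA) (haα hC) hBm hAm hCm
  have t3 := hG.not_crosses_of_crosses hα hm hmα (haα hA) (haα hC) (haα hB) hAm hCm hBm
  have t4 := hG.crosses_trans hα hm hmα (haα hA) (haα hC) (haα hB) hAm hCm hBm
  have t5 := hG.not_crosses_of_crosses hα hm hmα (haα hA) (haα hB) (haα hC) hAm hBm hCm
  have t6 := hG.not_crosses_of_crosses hα hm hmα (haα hB) (haα hA) (haα hC) hBm hAm hCm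
  rw [hG.crosses_comm (A := B) (B := A)] at t2 t6
  rw [hG.crosses_comm (A := C) (B := B)] at t3 t4
  grind

/-- The ray from `O` through `I` is declared positive. From `X ≠ O`, the points after `X` are those
beyond `X` as seen from `O` when `X` is positive, and those on the side of `O` otherwise. The order
axioms follow from `hdir` (the points after `A` fill one side of `A`) and `hasymm`. -/
theorem exists_orients (hG : G.IsEuclidean) {a : Set P} (ha : G.IsLine a) :
    ∃ r, G.Orients a r := by
  obtain ⟨O, hO, I, hI, hOI⟩ := hG.line_two_points a ha
  obtain ⟨r, hr⟩ : ∃ r : P → P → Prop, ∀ X Y, r X Y ↔ (X = O ∧ Y ≠ O ∧ ¬ G.Btw Y O I) ∨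
      (X ≠ O ∧ X ≠ Y ∧ (G.Btw O X Y ↔ ¬ G.Btw X O I)) := ⟨_, fun _ _ => Iff.rfl⟩
  have hne := hG.btw_line
  have hdir : ∀ A ∈ a, ∀ X ∈ a, ∀ Y ∈ a, X ≠ A → Y ≠ A →
      ((r A X ↔ r A Y) ↔ ¬ G.Btw X A Y) := by
    intro A hA X hX Y hY hXA hYA
    -- The reference point for the sides of `A` is `I` when `A = O` and `O` itself otherwise, as in
    -- the two clauses defining `r`.
    by_cases hAO : A = O
    · subst hAO
      have := hG.btw_iff_btw_iff ha hA hX hY hI hXA hYA hOI.symm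
      rw [hr, hr]
      tauto
    · have := hG.btw_iff_btw_iff ha hA hX hY hO hXA hYA (Ne.symm hAO)
      rw [hG.btw_comm (A := X) (C := O), hG.btw_comm (A := Y) (C := O)] at this
      rw [hr, hr]
      have := hXA.symm
      have := hYA.symm
      tauto
  have hirr : ∀ A, ¬ r A A := by
    intro A
    rw [hr]
    tauto
  have hasymm : ∀ X ∈ a, ∀ Y ∈ a, X ≠ Y → (r X Y ↔ ¬ r Y X) := by
    intro X hX Y hY hXY
    have hO' : ∀ Z, ¬ G.Btw O Z O := fun Z h => (hne _ _ _ h).2.2.1 rfl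
    rw [hr, hr]
    by_cases hXO : X = O
    · subst hXO
      have := hO' Y
      have := hXY.symm
      tauto
    by_cases hYO : Y = O
    · subst hYO
      have := hO' X
      have := hXY.symm
      tauto
    have h1 := hG.btw_iff_btw_iff ha hO hX hY hI hXO hYO hOI.symm
    have h2 := hG.btw_total ha hO hX hY (Ne.symm hXO) hXY (Ne.symm hYO)
    have h3 := hG.btw_unique O X Y
    have h4 := hG.btw_unique O Y X
    have h5 := hG.btw_comm (A := X) (B := O) (C := Y)
    have h6 := hG.btw_comm (A := O) (B := X) (C := Y)
    have := hXY.symm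
    grind
  have htrans : ∀ A ∈ a, ∀ B ∈ a, ∀ C ∈ a, r A B → r B C → r A C := by
    intro A hA B hB C hC hAB hBC
    have h1 : A ≠ B := by rintro rfl; exact hirr A hAB
    have h2 : B ≠ C := by rintro rfl; exact hirr B hBC
    have h3 := (hasymm A hA B hB h1).1 hAB
    have h4 : A ≠ C := by rintro rfl; exact h3 hBC
    have h5 := hdir A hA B hB C hC h1.symm h4.symm
    have h6 := hdir B hB A hA C hC h1 h2.symm
    -- If `r A C` failed, `A` would lie between `B` and `C`, while `B` lies between `A` and `C`.
    by_contra h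
    exact (hG.btw_unique A B C (by tauto)).2 (hG.btw_symm _ _ _ (by tauto))
  refine ⟨r, fun A _ => hirr A, htrans, fun A hA B hB h => ?_, fun A hA B hB C hC => ?_⟩
  · have := hasymm A hA B hB h
    tauto
  · by_cases hAB : A = B
    · subst hAB
      have := hirr A
      have := fun h => (hne A A C h).1 rfl
      tauto
    by_cases hBC : B = C
    · subst hBC
      have := hirr B
      have := fun h => (hne A B B h).2.1 rfl
      tauto
    have h1 := hdir B hB A hA C hC hAB (Ne.symm hBC)
    have h2 := hasymm A hA B hB hAB
    have h3 := hasymm B hB C hC hBC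
    rw [← not_iff_not, ← h1, h2, h3]
    grind

theorem exists_gt (hG : G.IsEuclidean) {a : Set P} {r : P → P → Prop} (ha : G.IsLine a)
    (hr : G.Orients a r) {A : P} (hA : A ∈ a) : ∃ B ∈ a, r A B := by
  obtain ⟨B, hB, hBA⟩ := hG.exists_ne_mem ha A
  rcases hr.total A hA B hB hBA.symm with h | h
  · exact ⟨B, hB, h⟩
  · obtain ⟨C, hC⟩ := hG.btw_extend B A hBA
    have hCa := hG.mem_of_btw' ha hC hB hA
    rcases (hr.btw B hB A hA C hCa).1 hC with h' | h'
    · exact ⟨C, hCa, h'.2⟩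
    · exact absurd h (hr.asymm hA hB h'.2)

theorem exists_gt_gt (hG : G.IsEuclidean) {a : Set P} {r : P → P → Prop} (ha : G.IsLine a)
    (hr : G.Orients a r) {A A' : P} (hA : A ∈ a) (hA' : A' ∈ a) : ∃ B ∈ a, r A B ∧ r A' B := by
  obtain ⟨B, hB, hAB⟩ := hG.exists_gt ha hr hA
  obtain ⟨B', hB', hAB'⟩ := hG.exists_gt ha hr hA'
  by_cases h : A = A'
  · exact ⟨B, hB, hAB, h ▸ hAB⟩
  · rcases hr.total A hA A' hA' h with h | h
    · exact ⟨B', hB', hr.trans _ hA _ hA' _ hB' h hAB', hAB'⟩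
    · exact ⟨B, hB, hAB, hr.trans _ hA' _ hA _ hB h hAB⟩

theorem exists_orients_rel (hG : G.IsEuclidean) {a : Set P} {A B : P} (ha : G.IsLine a)
    (hA : A ∈ a) (hB : B ∈ a) (h : A ≠ B) : ∃ r, G.Orients a r ∧ r A B := by
  obtain ⟨r, hr⟩ := hG.exists_orients ha
  rcases hr.total A hA B hB h with h | h
  · exact ⟨r, hr, h⟩
  · exact ⟨_, hr.symm, h⟩

/-! ### Codirected vectors on one line -/

theorem monotonic_rel {a : Set P} {r : P → P → Prop} {n : ℕ} {s : ℕ → P}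
    (hr : G.Orients a r) (hs : G.Monotonic a n s) (h0 : r (s 0) (s 1)) :
    ∀ i k, i < k → k < n → r (s i) (s k) := by
  obtain ⟨-, hmem, hb⟩ := hs
  have step : ∀ i, i + 1 < n → r (s i) (s (i + 1)) := by
    intro i
    induction i with
    | zero => exact fun _ => h0
    | succ i ih =>
      intro hi
      have h1 := ih (by omega)
      have h2 := (hr.btw _ (hmem i (by omega)) _ (hmem (i + 1) (by omega)) _
        (hmem (i + 2) (by omega))).1 (hb i (by omega))
      have := hr.asymm (hmem i (by omega)) (hmem (i + 1) (by omega)) h1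
      tauto
  intro i k hik
  induction k, hik using Nat.le_induction with
  | base => exact step i
  | succ k hk ih =>
    intro hkn
    exact hr.trans _ (hmem i (by omega)) _ (hmem k (by omega)) _ (hmem (k + 1) hkn)
      (ih (by omega)) (step k hkn)

theorem rel_iff_of_monotonic {a : Set P} {r : P → P → Prop} {n : ℕ} {s : ℕ → P}
    (hr : G.Orients a r) (hs : G.Monotonic a n s) (h0 : r (s 0) (s 1)) {i k : ℕ}
    (hi : i < n) (hk : k < n) : r (s i) (s k) ↔ i < k := by
  refine ⟨fun h => ?_, fun h => monotonic_rel hr hs h0 i k h hk⟩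
  by_contra hik
  rcases eq_or_lt_of_le (not_lt.1 hik) with rfl | h'
  · exact hr.irrefl _ (hs.2.1 _ hi) h
  · exact hr.asymm (hs.2.1 i hi) (hs.2.1 k hk) h (monotonic_rel hr hs h0 k i h' hi)

/-- A finite subset of `a` is enumerated in increasing order of `r`. -/
theorem exists_monotonic (hG : G.IsEuclidean) {a : Set P} {r : P → P → Prop} (ha : G.IsLine a)
    (hr : G.Orients a r) (t : Finset P) (ht : ∀ X ∈ t, X ∈ a) :
    ∃ n s, G.Monotonic a n s ∧ r (s 0) (s 1) ∧ ∀ X ∈ t, ∃ i < n, s i = X := by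
  classical
  obtain ⟨A, hA, -⟩ := hG.line_two_points a ha
  obtain ⟨B, hB, hAB⟩ := hG.exists_gt ha hr hA
  obtain ⟨C, hC, hBC⟩ := hG.exists_gt ha hr hB
  let L : LinearOrder a :=
    { le := fun X Y => X = Y ∨ r X Y
      lt := fun X Y => r X Y
      le_refl := fun X => Or.inl rfl
      le_trans := by
        rintro X Y Z (rfl | h1) (rfl | h2)
        · exact Or.inl rfl
        · exact Or.inr h2
        · exact Or.inr h1
        · exact Or.inr (hr.trans _ X.2 _ Y.2 _ Z.2 h1 h2)
      le_antisymm := by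
        rintro X Y (h1 | h1) (h2 | h2)
        · exact h1
        · exact h1
        · exact h2.symm
        · exact absurd h2 (hr.asymm X.2 Y.2 h1)
      lt_iff_le_not_ge := by
        intro X Y
        have h1 := hr.irrefl X X.2
        have h2 := fun h => hr.asymm X.2 Y.2 h
        constructor
        · intro h
          refine ⟨Or.inr h, ?_⟩
          rintro (rfl | h')
          · exact h1 h
          · exact h2 h h'
        · rintro ⟨rfl | h, h'⟩
          · exact absurd (Or.inl rfl) h'
          · exact h
      le_total := by
        intro X Y
        by_cases h : X = Y
        · exact Or.inl (Or.inl h)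
        · rcases hr.total X X.2 Y Y.2 (fun h' => h (Subtype.ext h')) with h | h
          · exact Or.inl (Or.inr h)
          · exact Or.inr (Or.inr h)
      toDecidableLE := Classical.decRel _ }
  have hlt : ∀ X Y : a, X < Y → r X Y := fun _ _ h => h
  -- The points `A`, `B`, `C`, increasing for `r`, guarantee the length of at least 3 that
  -- `Monotonic` demands.
  let T : Finset a := t.subtype (· ∈ a) ∪ {⟨A, hA⟩, ⟨B, hB⟩, ⟨C, hC⟩}
  have hcard : 3 ≤ T.card := by
    have h3 : ({⟨A, hA⟩, ⟨B, hB⟩, ⟨C, hC⟩} : Finset a).card = 3 := by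
      rw [Finset.card_eq_three]
      refine ⟨_, _, _, ?_, ?_, ?_, rfl⟩
      · exact fun h => hr.ne hA hAB (Subtype.ext_iff.1 h)
      · exact fun h => hr.ne hA (hr.trans _ hA _ hB _ hC hAB hBC) (Subtype.ext_iff.1 h)
      · exact fun h => hr.ne hB hBC (Subtype.ext_iff.1 h)
    rw [← h3]
    exact Finset.card_le_card Finset.subset_union_right
  let e := T.orderEmbOfFin rfl
  let s : ℕ → P := fun i => if h : i < T.card then (e ⟨i, h⟩ : a) else A
  have hs : ∀ i (h : i < T.card), s i = (e ⟨i, h⟩ : a) := fun i h => dif_pos h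
  have hrel : ∀ i, i + 1 < T.card → r (s i) (s (i + 1)) := by
    intro i hi
    rw [hs i (by omega), hs (i + 1) hi]
    exact hlt _ _ (e.lt_iff_lt.2 (by simp [Fin.lt_def]))
  have hmem : ∀ i, i < T.card → s i ∈ a := by
    intro i hi
    rw [hs i hi]
    exact (e ⟨i, hi⟩).2
  refine ⟨T.card, s, ⟨hcard, hmem, fun i hi => ?_⟩, hrel 0 (by omega), fun X hX => ?_⟩
  · exact (hr.btw _ (hmem i (by omega)) _ (hmem (i + 1) (by omega)) _ (hmem (i + 2) hi)).2
      (Or.inl ⟨hrel i (by omega), hrel (i + 1) hi⟩)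
  · have hXT : (⟨X, ht X hX⟩ : a) ∈ T := Finset.mem_union_left _ (Finset.mem_subtype.2 hX)
    have : (⟨X, ht X hX⟩ : a) ∈ Set.range e := by
      rw [Finset.range_orderEmbOfFin]
      exact hXT
    obtain ⟨i, hi⟩ := this
    exact ⟨i, i.2, by rw [hs i i.2, hi]⟩

/-- A monotonic sequence is increasing for `r` or for its reverse, so comparing indices is comparing
points. This removes the choice of sequence. -/
theorem codirectedOnLine_iff (hG : G.IsEuclidean) {a : Set P} {r : P → P → Prop}
    (hr : G.Orients a r) {u v : GeomVector P} (h : G.BothOn u v a) :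
    G.CodirectedOnLine u v ↔ (r u.src u.tgt ↔ r v.src v.tgt) := by
  classical
  obtain ⟨ha, hus, hut, hvs, hvt⟩ := h
  constructor
  · rintro ⟨b, ⟨hb, hbus, hbut, -, -⟩, n, s, hs, i, k, j, q, hi, hk, hj, hq, h1, h2, h3, h4, hsg⟩
    obtain rfl := hG.line_eq hb ha u.ne hbus hbut hus hut
    have main : ∀ r, G.Orients b r → r (s 0) (s 1) → (r u.src u.tgt ↔ r v.src v.tgt) := by
      intro r hr h0
      rw [← h1, ← h2, ← h3, ← h4, rel_iff_of_monotonic hr hs h0 hi hk,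
        rel_iff_of_monotonic hr hs h0 hj hq]
      have e1 := Int.sign_eq_one_iff_pos (a := (k : ℤ) - i)
      have e2 := Int.sign_eq_one_iff_pos (a := (q : ℤ) - j)
      rw [hsg] at e1
      omega
    have h01 : s 0 ≠ s 1 := by
      have := hs.1
      exact (hG.btw_line _ _ _ (hs.2.2 0 (by omega))).1
    have h3 := hs.1
    rcases hr.total _ (hs.2.1 0 (by omega)) _ (hs.2.1 1 (by omega)) h01 with h0 | h0
    · exact main r hr h0
    -- For a decreasing sequence, the reversed order is used; it negates both sides of the
    -- equivalence.
    · rw [← not_iff_not, hr.not_iff hus hut u.ne, hr.not_iff hvs hvt v.ne]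
      exact main _ hr.symm h0
  · intro h
    obtain ⟨n, s, hs, h0, hall⟩ := hG.exists_monotonic ha hr {u.src, u.tgt, v.src, v.tgt} (by
      intro X hX
      simp only [Finset.mem_insert, Finset.mem_singleton] at hX
      rcases hX with rfl | rfl | rfl | rfl <;> assumption)
    obtain ⟨i, hi, h1⟩ := hall u.src (by simp)
    obtain ⟨k, hk, h2⟩ := hall u.tgt (by simp)
    obtain ⟨j, hj, h3⟩ := hall v.src (by simp)
    obtain ⟨q, hq, h4⟩ := hall v.tgt (by simp)
    refine ⟨a, ⟨ha, hus, hut, hvs, hvt⟩, n, s, hs, i, k, j, q, hi, hk, hj, hq, h1, h2, h3, h4, ?_⟩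
    have hik : i ≠ k := fun h => u.ne (by rw [← h1, ← h2, h])
    have hjq : j ≠ q := fun h => v.ne (by rw [← h3, ← h4, h])
    rw [← h1, ← h2, ← h3, ← h4, rel_iff_of_monotonic hr hs h0 hi hk,
      rel_iff_of_monotonic hr hs h0 hj hq] at h
    rcases lt_or_gt_of_ne hik with h' | h'
    · have h'' := h.1 h'
      rw [Int.sign_eq_one_of_pos (by omega), Int.sign_eq_one_of_pos (by omega)]
    · have h'' : q < j := by omega
      rw [Int.sign_eq_neg_one_of_neg (by omega), Int.sign_eq_neg_one_of_neg (by omega)]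

/-! ### Two parallel lines -/

theorem notMem_of_transversal (hG : G.IsEuclidean) {a m : Set P} {A B C : P} (ha : G.IsLine a)
    (hm : G.IsLine m) (hA : A ∈ a) (hB : B ∈ a) (hAB : A ≠ B) (hAm : A ∈ m) (hCm : C ∈ m)
    (hC : C ∉ a) : B ∉ m :=
  fun hBm => hAB (hG.eq_of_mem hm ha hAm hA hBm hB hCm hC)

theorem not_crosses_of_disjoint (hG : G.IsEuclidean) {a b : Set P} {C D : P} (hb : G.IsLine b)
    (hab : Disjoint a b) (hC : C ∈ b) (hD : D ∈ b) : ¬ G.Crosses a C D :=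
  fun ⟨_, hX, h⟩ => Set.disjoint_left.1 hab hX (hG.mem_of_btw hb h hC hD)

/-- The part of a transversal segment `[BD]` of a strip lies in the strip. -/
theorem not_btw_of_strip (hG : G.IsEuclidean) {α a b : Set P} {A B C D X : P}
    (hα : G.IsPlane α) (ha : G.IsLine a) (hb : G.IsLine b) (haα : a ⊆ α) (hbα : b ⊆ α)
    (hab : Disjoint a b) (hA : A ∈ a) (hB : B ∈ a) (hC : C ∈ b) (hD : D ∈ b)
    (hX : G.Btw B X D) : ¬ G.Btw X A C := by
  intro h
  have hCa : C ∉ a := Set.disjoint_right.1 hab hC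
  have hDa : D ∉ a := Set.disjoint_right.1 hab hD
  have hXa : X ∉ a := fun hXa => hCa (hG.mem_of_btw' ha h hXa hA)
  -- `C`, `D` and `X` are on one side of `a`: the line `BD` meets `a` only at `B`, which is not
  -- between `D` and `X`. But `A` would separate `X` from `C`.
  refine hG.crosses_trans hα ha haα (hbα hC) (hbα hD)
    (hG.btw_mem_plane hα hX (haα hB) (hbα hD)) hCa hDa hXa
    (hG.not_crosses_of_disjoint hb hab hC hD) ?_ ⟨A, hA, hG.btw_symm _ _ _ h⟩
  rintro ⟨Z, hZa, hZ⟩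
  obtain ⟨p, hp, hBp, hDp⟩ := hG.exists_line (hG.btw_line _ _ _ hX).2.2.1
  have hZB : Z = B := hG.eq_of_mem hp ha
    (hG.mem_of_btw hp hZ hDp (hG.mem_of_btw hp hX hBp hDp)) hZa hBp hB hDp hDa
  subst hZB
  exact (hG.btw_unique _ _ _ hX).2 hZ

/-- By `not_btw_of_strip`, used for each boundary line, a point of `m` inside `[BD]` must lie on
`[AC]`. Disjointness thus becomes a same-side condition, to which `crosses_trans` applies. -/
theorem disjoint_seg_iff (hG : G.IsEuclidean) {α a b m : Set P} {A B C D : P}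
    (hα : G.IsPlane α) (ha : G.IsLine a) (hb : G.IsLine b) (haα : a ⊆ α) (hbα : b ⊆ α)
    (hab : Disjoint a b) (hA : A ∈ a) (hB : B ∈ a) (hAB : A ≠ B) (hC : C ∈ b) (hD : D ∈ b)
    (hCD : C ≠ D) (hm : G.IsLine m) (hAm : A ∈ m) (hCm : C ∈ m) :
    Disjoint (G.seg B D) (G.seg A C) ↔ ¬ G.Crosses m B D := by
  have hCa : C ∉ a := Set.disjoint_right.1 hab hC
  have hAb : A ∉ b := Set.disjoint_left.1 hab hA
  have hBm := hG.notMem_of_transversal ha hm hA hB hAB hAm hCm hCa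
  have hDm := hG.notMem_of_transversal hb hm hC hD hCD hCm hAm hAb
  constructor
  · rintro h ⟨X, hXm, hX⟩
    have hXs : X ∉ G.seg A C := Set.disjoint_left.1 h (Or.inr (Or.inr hX))
    have hXA : A ≠ X := fun h => hXs (Or.inl h.symm)
    have hXC : C ≠ X := fun h => hXs (Or.inr (Or.inl h.symm))
    have hAC : A ≠ C := fun h => hCa (h ▸ hA)
    rcases hG.btw_total hm hAm hCm hXm hAC hXC hXA with h' | h' | h'
    · exact hG.not_btw_of_strip hα hb ha hbα haα hab.symm hC hD hA hB (hG.btw_symm _ _ _ hX)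
        (hG.btw_symm _ _ _ h')
    · exact hG.not_btw_of_strip hα ha hb haα hbα hab hA hB hC hD hX (hG.btw_symm _ _ _ h')
    · exact hXs (Or.inr (Or.inr h'))
  · intro h
    rw [Set.disjoint_left]
    intro Z hZ hZ'
    have hZm : Z ∈ m := by
      rcases hZ' with rfl | rfl | hZ'
      · exact hAm
      · exact hCm
      · exact hG.mem_of_btw hm hZ' hAm hCm
    rcases hZ with rfl | rfl | hZ
    · exact hBm hZm
    · exact hDm hZm
    · exact h ⟨Z, hZm, hZ⟩

theorem not_crosses_of_rel_iff (hG : G.IsEuclidean) {a m : Set P} {r : P → P → Prop} {A B B' C : P}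
    (ha : G.IsLine a) (hr : G.Orients a r) (hm : G.IsLine m) (hA : A ∈ a) (hB : B ∈ a)
    (hB' : B' ∈ a) (hAm : A ∈ m) (hCm : C ∈ m) (hC : C ∉ a) (h : r A B) (h' : r A B') :
    ¬ G.Crosses m B B' := by
  rintro ⟨X, hXm, hX⟩
  have : X = A := hG.eq_of_mem hm ha hXm (hG.mem_of_btw ha hX hB hB') hAm hA hCm hC
  subst this
  have h1 := hr.asymm hA hB h
  have h2 := hr.asymm hA hB' h'
  rcases (hr.btw _ hB _ hA _ hB').1 hX with h | h
  · exact h1 h.1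
  · exact h2 h.1

/-- Moving the ending points along their rays from `A` and `C` keeps them on their sides of the line
`AC`. -/
theorem disjoint_seg_of_rel (hG : G.IsEuclidean) {α a b : Set P} {r r' : P → P → Prop}
    {A B C D B' D' : P} (hα : G.IsPlane α) (ha : G.IsLine a) (hb : G.IsLine b) (haα : a ⊆ α)
    (hbα : b ⊆ α) (hab : Disjoint a b) (hr : G.Orients a r) (hr' : G.Orients b r')
    (hA : A ∈ a) (hB : B ∈ a) (hC : C ∈ b) (hD : D ∈ b) (hB' : B' ∈ a) (hD' : D' ∈ b)
    (h1 : r A B) (h2 : r A B') (h3 : r' C D) (h4 : r' C D')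
    (h : Disjoint (G.seg B D) (G.seg A C)) : Disjoint (G.seg B' D') (G.seg A C) := by
  have hCa : C ∉ a := Set.disjoint_right.1 hab hC
  have hAb : A ∉ b := Set.disjoint_left.1 hab hA
  have hAC : A ≠ C := fun h => hCa (h ▸ hA)
  obtain ⟨m, hm, hAm, hCm⟩ := hG.exists_line hAC
  have hmα := hG.line_subset_plane m α hm hα A hAm C hCm hAC (haα hA) (hbα hC)
  have na : ∀ X ∈ a, r A X → X ∉ m := fun X hX h =>
    hG.notMem_of_transversal ha hm hA hX (hr.ne hA h) hAm hCm hCa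
  have nb : ∀ X ∈ b, r' C X → X ∉ m := fun X hX h =>
    hG.notMem_of_transversal hb hm hC hX (hr'.ne hC h) hCm hAm hAb
  rw [hG.disjoint_seg_iff hα ha hb haα hbα hab hA hB (hr.ne hA h1) hC hD (hr'.ne hC h3) hm hAm
    hCm] at h
  rw [hG.disjoint_seg_iff hα ha hb haα hbα hab hA hB' (hr.ne hA h2) hC hD' (hr'.ne hC h4) hm hAm
    hCm]
  have e1 := hG.not_crosses_of_rel_iff ha hr hm hA hB' hB hAm hCm hCa h2 h1
  have e2 := hG.not_crosses_of_rel_iff hb hr' hm hC hD hD' hCm hAm hAb h3 h4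
  have e3 := hG.crosses_trans hα hm hmα (haα hB') (haα hB) (hbα hD) (na _ hB' h2) (na _ hB h1)
    (nb _ hD h3) e1 h
  exact hG.crosses_trans hα hm hmα (haα hB') (hbα hD) (hbα hD') (na _ hB' h2) (nb _ hD h3)
    (nb _ hD' h4) e3 e2

theorem not_disjoint_seg_of_rel (hG : G.IsEuclidean) {α a b : Set P} {r' : P → P → Prop}
    {A B C D D' : P} (hα : G.IsPlane α) (ha : G.IsLine a) (hb : G.IsLine b) (haα : a ⊆ α)
    (hbα : b ⊆ α) (hab : Disjoint a b) (hr' : G.Orients b r')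
    (hA : A ∈ a) (hB : B ∈ a) (hAB : A ≠ B) (hC : C ∈ b) (hD : D ∈ b) (hD' : D' ∈ b)
    (h3 : r' C D) (h4 : r' D' C)
    (h : Disjoint (G.seg B D) (G.seg A C)) : ¬ Disjoint (G.seg B D') (G.seg A C) := by
  have hCa : C ∉ a := Set.disjoint_right.1 hab hC
  have hAb : A ∉ b := Set.disjoint_left.1 hab hA
  have hAC : A ≠ C := fun h => hCa (h ▸ hA)
  have hCD := hr'.ne hC h3
  have hCD' := (hr'.ne hD' h4).symm
  obtain ⟨m, hm, hAm, hCm⟩ := hG.exists_line hAC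
  have hmα := hG.line_subset_plane m α hm hα A hAm C hCm hAC (haα hA) (hbα hC)
  rw [hG.disjoint_seg_iff hα ha hb haα hbα hab hA hB hAB hC hD hCD hm hAm hCm] at h
  rw [hG.disjoint_seg_iff hα ha hb haα hbα hab hA hB hAB hC hD' hCD' hm hAm hCm]
  intro h'
  refine hG.crosses_trans hα hm hmα (hbα hD) (haα hB) (hbα hD')
    (hG.notMem_of_transversal hb hm hC hD hCD hCm hAm hAb)
    (hG.notMem_of_transversal ha hm hA hB hAB hAm hCm hCa)
    (hG.notMem_of_transversal hb hm hC hD' hCD' hCm hAm hAb)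
    (fun h'' => h (hG.crosses_comm.1 h'')) h' ⟨C, hCm, ?_⟩
  exact (hr'.btw _ hD _ hC _ hD').2 (Or.inr ⟨h4, h3⟩)

/-- Two points of `b` separated by `C` are on opposite sides of the line `AC`, so one of them is on
the side of `B`. -/
theorem exists_disjoint_seg (hG : G.IsEuclidean) {α a b : Set P}
    {A B C : P} (hα : G.IsPlane α) (ha : G.IsLine a) (hb : G.IsLine b) (haα : a ⊆ α)
    (hbα : b ⊆ α) (hab : Disjoint a b) (hA : A ∈ a) (hB : B ∈ a) (hAB : A ≠ B) (hC : C ∈ b) :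
    ∃ D ∈ b, C ≠ D ∧ Disjoint (G.seg B D) (G.seg A C) := by
  have hCa : C ∉ a := Set.disjoint_right.1 hab hC
  have hAb : A ∉ b := Set.disjoint_left.1 hab hA
  have hAC : A ≠ C := fun h => hCa (h ▸ hA)
  obtain ⟨m, hm, hAm, hCm⟩ := hG.exists_line hAC
  have hmα := hG.line_subset_plane m α hm hα A hAm C hCm hAC (haα hA) (hbα hC)
  obtain ⟨D, hD, hDC⟩ := hG.exists_ne_mem hb C
  obtain ⟨D', hD'⟩ := hG.btw_extend D C hDC
  have hD'b := hG.mem_of_btw' hb hD' hD hC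
  have hCD' := (hG.btw_line _ _ _ hD').2.1
  by_contra! hcon
  have h1 := hcon D hD hDC.symm
  have h2 := hcon D' hD'b hCD'
  rw [hG.disjoint_seg_iff hα ha hb haα hbα hab hA hB hAB hC hD hDC.symm hm hAm hCm, not_not,
    hG.crosses_comm] at h1
  rw [hG.disjoint_seg_iff hα ha hb haα hbα hab hA hB hAB hC hD'b hCD' hm hAm hCm, not_not] at h2
  exact hG.not_crosses_of_crosses hα hm hmα (hbα hD) (haα hB) (hbα hD'b)
    (hG.notMem_of_transversal hb hm hC hD hDC.symm hCm hAm hAb)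
    (hG.notMem_of_transversal ha hm hA hB hAB hAm hCm hCa)
    (hG.notMem_of_transversal hb hm hC hD'b hCD' hCm hAm hAb) h1 h2 ⟨C, hCm, hD'⟩

/-- A single pair of vectors with disjoint connecting segments fixes `r'`. The work is to show that
the initial points do not matter. -/
theorem exists_orients_disjoint_seg_iff (hG : G.IsEuclidean) {α a b : Set P} {r : P → P → Prop}
    (hα : G.IsPlane α) (ha : G.IsLine a) (hb : G.IsLine b) (haα : a ⊆ α)
    (hbα : b ⊆ α) (hab : Disjoint a b) (hr : G.Orients a r) :
    ∃ r', G.Orients b r' ∧ ∀ A ∈ a, ∀ B ∈ a, ∀ C ∈ b, ∀ D ∈ b, A ≠ B → C ≠ D →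
      (Disjoint (G.seg B D) (G.seg A C) ↔ (r A B ↔ r' C D)) := by
  obtain ⟨A₀, hA₀, -⟩ := hG.line_two_points a ha
  obtain ⟨C₀, hC₀, -⟩ := hG.line_two_points b hb
  obtain ⟨B₀, hB₀, hAB₀⟩ := hG.exists_gt ha hr hA₀
  obtain ⟨D₀, hD₀, hne, hdis⟩ := hG.exists_disjoint_seg hα ha hb haα hbα hab hA₀ hB₀
    (hr.ne hA₀ hAB₀) hC₀
  obtain ⟨r', hr', hCD₀⟩ := hG.exists_orients_rel hb hC₀ hD₀ hne
  have pos : ∀ A ∈ a, ∀ B ∈ a, ∀ C ∈ b, ∀ D ∈ b, r A B → r' C D →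
      Disjoint (G.seg B D) (G.seg A C) := by
    intro A hA B hB C hC D hD hAB hCD
    -- Ending points beyond both old and new initial points are reached first. Disjointness is
    -- symmetric in initial and ending points, so under the reversed orders the initial points move
    -- to `A` and `C` as ending points; then `B'`, `D'` are moved to `B`, `D`.
    obtain ⟨B', hB', h1, h2⟩ := hG.exists_gt_gt ha hr hA₀ hA
    obtain ⟨D', hD', h3, h4⟩ := hG.exists_gt_gt hb hr' hC₀ hC
    have e1 := hG.disjoint_seg_of_rel hα ha hb haα hbα hab hr hr' hA₀ hB₀ hC₀ hD₀ hB' hD'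
      hAB₀ h1 hCD₀ h3 hdis
    have e2 := hG.disjoint_seg_of_rel hα ha hb haα hbα hab hr.symm hr'.symm hB' hA₀ hD' hC₀ hA hC
      h1 h2 h3 h4 e1.symm
    exact hG.disjoint_seg_of_rel hα ha hb haα hbα hab hr hr' hA hB' hC hD' hB hD h2 hAB h4 hCD
      e2.symm
  have neg : ∀ A ∈ a, ∀ B ∈ a, ∀ C ∈ b, ∀ D ∈ b, r A B → r' D C →
      ¬ Disjoint (G.seg B D) (G.seg A C) := by
    intro A hA B hB C hC D hD hAB hDC
    obtain ⟨D', hD', h⟩ := hG.exists_gt hb hr' hC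
    exact hG.not_disjoint_seg_of_rel hα ha hb haα hbα hab hr' hA hB (hr.ne hA hAB) hC hD' hD h hDC
      (pos A hA B hB C hC D' hD' hAB h)
  refine ⟨r', hr', fun A hA B hB C hC D hD hAB hCD => ?_⟩
  rcases hr.total A hA B hB hAB with h1 | h1 <;> rcases hr'.total C hC D hD hCD with h2 | h2
  · exact iff_of_true (pos A hA B hB C hC D hD h1 h2) (iff_of_true h1 h2)
  · exact iff_of_false (neg A hA B hB C hC D hD h1 h2)
      (fun h => hr'.asymm hD hC h2 (h.1 h1))
  · exact iff_of_false (fun h => neg B hB A hA D hD C hC h1 h2 h.symm)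
      (fun h => hr.asymm hB hA h1 (h.2 h2))
  · exact iff_of_true (pos B hB A hA D hD C hC h1 h2).symm
      (iff_of_false (hr.asymm hB hA h1) (hr'.asymm hD hC h2))

theorem parallel_symm {a b : Set P} (h : G.Parallel a b) : G.Parallel b a := by
  rcases h with h | ⟨⟨α, hα, h1, h2⟩, h⟩
  · exact Or.inl h.symm
  · exact Or.inr ⟨⟨α, hα, h2, h1⟩, h.symm⟩

theorem codirected_iff_disjoint_seg (hG : G.IsEuclidean) {a b : Set P} {u v : GeomVector P}
    (ha : G.IsLine a) (hb : G.IsLine b) (hab : G.Parallel a b) (hne : a ≠ b) (hus : u.src ∈ a)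
    (hut : u.tgt ∈ a) (hvs : v.src ∈ b) (hvt : v.tgt ∈ b) :
    G.Codirected u v ↔ Disjoint (G.seg u.tgt v.tgt) (G.seg u.src v.src) := by
  have hnot : ¬ ∃ c, G.BothOn u v c := by
    rintro ⟨c, hc, h1, h2, h3, h4⟩
    exact hne ((hG.line_eq ha hc u.ne hus hut h1 h2).trans
      (hG.line_eq hc hb v.ne h3 h4 hvs hvt))
  constructor
  · rintro (⟨c, hc, -⟩ | h)
    · exact absurd ⟨c, hc⟩ hnot
    · exact h.2.2
  · exact fun h => Or.inr ⟨hnot, ⟨a, b, ha, hb, hus, hut, hvs, hvt, hab⟩, h⟩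

theorem codirected_iff_of_bothOn (hG : G.IsEuclidean) {a : Set P} {r : P → P → Prop}
    (hr : G.Orients a r) {u v : GeomVector P} (h : G.BothOn u v a) :
    G.Codirected u v ↔ (r u.src u.tgt ↔ r v.src v.tgt) := by
  rw [← hG.codirectedOnLine_iff hr h]
  refine ⟨?_, Or.inl⟩
  rintro (h' | h')
  · exact h'
  · exact absurd ⟨a, h⟩ h'.1

/-- Parallel lines can be oriented consistently. -/
theorem exists_orients_codirected_iff (hG : G.IsEuclidean) {a b : Set P} {r : P → P → Prop}
    (ha : G.IsLine a) (hb : G.IsLine b) (hab : G.Parallel a b) (hr : G.Orients a r) :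
    ∃ r', G.Orients b r' ∧ ∀ u v : GeomVector P, u.src ∈ a → u.tgt ∈ a → v.src ∈ b → v.tgt ∈ b →
      (G.Codirected u v ↔ (r u.src u.tgt ↔ r' v.src v.tgt)) := by
  by_cases hne : a = b
  · subst hne
    exact ⟨r, hr, fun u v h1 h2 h3 h4 => hG.codirected_iff_of_bothOn hr ⟨ha, h1, h2, h3, h4⟩⟩
  · obtain ⟨⟨α, hα, haα, hbα⟩, hdis⟩ := hab.resolve_left hne
    obtain ⟨r', hr', h⟩ := hG.exists_orients_disjoint_seg_iff hα ha hb haα hbα hdis hr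
    refine ⟨r', hr', fun u v h1 h2 h3 h4 => ?_⟩
    rw [hG.codirected_iff_disjoint_seg ha hb hab hne h1 h2 h3 h4]
    exact h _ h1 _ h2 _ h3 _ h4 u.ne v.ne

theorem exists_parallel_of_codirected {u v : GeomVector P} (h : G.Codirected u v) :
    ∃ a b, G.IsLine a ∧ G.IsLine b ∧ u.src ∈ a ∧ u.tgt ∈ a ∧ v.src ∈ b ∧ v.tgt ∈ b ∧
      G.Parallel a b := by
  rcases h with ⟨a, ⟨ha, h1, h2, h3, h4⟩, -⟩ | ⟨-, h, -⟩
  · exact ⟨a, a, ha, ha, h1, h2, h3, h4, Or.inl rfl⟩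
  · exact h

/-! ### Three parallel lines -/

theorem parallel_eq (hG : G.IsEuclidean) {a b c : Set P} {X : P} (ha : G.IsLine a)
    (hb : G.IsLine b) (hc : G.IsLine c) (hba : G.Parallel b a) (hca : G.Parallel c a)
    (hXb : X ∈ b) (hXc : X ∈ c) : b = c := by
  by_cases hXa : X ∈ a
  · have h1 : b = a := hba.resolve_right fun h => Set.disjoint_left.1 h.2 hXb hXa
    have h2 : c = a := hca.resolve_right fun h => Set.disjoint_left.1 h.2 hXc hXa
    rw [h1, h2]
  · exact (hG.parallel_unique a X ha hXa).unique ⟨hb, hXb, hba⟩ ⟨hc, hXc, hca⟩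

/-- The issue is coplanarity when `a`, `b`, `c` are not in one plane. The plane through `a` and a
point `O` of `c` cuts the plane of `b` and `c` in a line `d` through `O`. A common point of `d` and
`b` would force `α = β`, so `d` is the parallel to `b` through `O`, which is `c`. -/
theorem parallel_trans (hG : G.IsEuclidean) {a b c : Set P} (ha : G.IsLine a)
    (hb : G.IsLine b) (hc : G.IsLine c) (hab : G.Parallel a b) (hbc : G.Parallel b c) :
    G.Parallel a c := by
  have hcb := parallel_symm hbc
  by_cases hdis : Disjoint a c
  swap
  · obtain ⟨X, hXa, hXc⟩ := Set.not_disjoint_iff.1 hdis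
    exact Or.inl (hG.parallel_eq hb ha hc hab hcb hXa hXc)
  rcases id hab with rfl | ⟨⟨α, hα, haα, hbα⟩, hab'⟩
  · exact hbc
  rcases id hbc with rfl | ⟨⟨β, hβ, hbβ, hcβ⟩, hbc'⟩
  · exact hab
  refine Or.inr ⟨?_, hdis⟩
  by_cases hαβ : α = β
  · exact ⟨α, hα, haα, hαβ ▸ hcβ⟩
  obtain ⟨O, hO, -⟩ := hG.line_two_points c hc
  have hOa : O ∉ a := Set.disjoint_right.1 hdis hO
  have hOb : O ∉ b := Set.disjoint_right.1 hbc' hO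
  obtain ⟨γ, hγ, haγ, hOγ⟩ := hG.exists_plane_of_line ha hOa
  by_cases hγβ : γ = β
  · exact ⟨γ, hγ, haγ, hγβ ▸ hcβ⟩
  obtain ⟨d, hd, hOd, hdeq⟩ := hG.exists_line_of_planes hγ hβ hγβ hOγ (hcβ hO)
  have hdγ : d ⊆ γ := hdeq ▸ Set.inter_subset_left
  have hdβ : d ⊆ β := hdeq ▸ Set.inter_subset_right
  have hdb : Disjoint d b := by
    rw [Set.disjoint_left]
    intro X hXd hXb
    have h1 : γ = α := hG.plane_eq_of_line ha hγ hα haγ haα (Set.disjoint_right.1 hab' hXb)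
      (hdγ hXd) (hbα hXb)
    exact hαβ (hG.plane_eq_of_line hb hα hβ hbα hbβ hOb (h1 ▸ hOγ) (hcβ hO))
  have hdc : d = c := hG.parallel_eq hb hd hc (Or.inr ⟨⟨β, hβ, hdβ, hbβ⟩, hdb⟩) hcb hOd hO
  exact ⟨γ, hγ, haγ, hdc ▸ hdγ⟩

/-- On three distinct parallel lines there are initial points for which codirectedness is
transitive. -/
theorem exists_disjoint_seg_trans (hG : G.IsEuclidean) {α β γ a b c : Set P} (ha : G.IsLine a)
    (hb : G.IsLine b) (hc : G.IsLine c) (hα : G.IsPlane α) (hβ : G.IsPlane β) (hγ : G.IsPlane γ)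
    (haα : a ⊆ α) (hbα : b ⊆ α) (hbβ : b ⊆ β) (hcβ : c ⊆ β) (haγ : a ⊆ γ) (hcγ : c ⊆ γ)
    (hab : Disjoint a b) (hbc : Disjoint b c) (hac : Disjoint a c) :
    ∃ A ∈ a, ∃ C ∈ b, ∃ E ∈ c, ∀ B ∈ a, ∀ D ∈ b, ∀ F ∈ c, A ≠ B → C ≠ D → E ≠ F →
      Disjoint (G.seg B D) (G.seg A C) → Disjoint (G.seg D F) (G.seg C E) →
      Disjoint (G.seg B F) (G.seg A E) := by
  obtain ⟨A, hA, -⟩ := hG.line_two_points a ha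
  obtain ⟨C, hC, -⟩ := hG.line_two_points b hb
  have hCa : C ∉ a := Set.disjoint_right.1 hab hC
  have hAb : A ∉ b := Set.disjoint_left.1 hab hA
  have hAc : A ∉ c := Set.disjoint_left.1 hac hA
  have hCc : C ∉ c := Set.disjoint_left.1 hbc hC
  have hAC : A ≠ C := fun h => hCa (h ▸ hA)
  obtain ⟨m, hm, hAm, hCm⟩ := hG.exists_line hAC
  have hmα := hG.line_subset_plane m α hm hα A hAm C hCm hAC (haα hA) (hbα hC)
  by_cases hcα : c ⊆ α
  -- Coplanar lines: the transversal `m` also meets `c`, since otherwise `m` and `a` would be two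
  -- parallels to `c` through `A`. All three conditions then refer to the sides of `m`.
  · obtain ⟨E, hEm, hE⟩ : ∃ E ∈ m, E ∈ c := by
      by_contra! h
      have hmc : G.Parallel m c := Or.inr ⟨⟨α, hα, hmα, hcα⟩, Set.disjoint_left.2 h⟩
      have : m = a := hG.parallel_eq hc hm ha hmc (Or.inr ⟨⟨γ, hγ, haγ, hcγ⟩, hac⟩) hAm hA
      exact hCa (this ▸ hCm)
    refine ⟨A, hA, C, hC, E, hE, fun B hB D hD F hF hAB hCD hEF h1 h2 => ?_⟩
    rw [hG.disjoint_seg_iff hα ha hb haα hbα hab hA hB hAB hC hD hCD hm hAm hCm] at h1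
    rw [hG.disjoint_seg_iff hα hb hc hbα hcα hbc hC hD hCD hE hF hEF hm hCm hEm] at h2
    rw [hG.disjoint_seg_iff hα ha hc haα hcα hac hA hB hAB hE hF hEF hm hAm hEm]
    exact hG.crosses_trans hα hm hmα (haα hB) (hbα hD) (hcα hF)
      (hG.notMem_of_transversal ha hm hA hB hAB hAm hCm hCa)
      (hG.notMem_of_transversal hb hm hC hD hCD hCm hAm hAb)
      (hG.notMem_of_transversal hc hm hE hF hEF hEm hAm hAc) h1 h2
  · have hnot : ∀ X ∈ c, X ∉ α := by
      intro X hX hXα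
      have : γ = α := hG.plane_eq_of_line ha hγ hα haγ haα (Set.disjoint_right.1 hac hX)
        (hcγ hX) hXα
      exact hcα (this ▸ hcγ)
    obtain ⟨E, hE, -⟩ := hG.line_two_points c hc
    have hEα := hnot E hE
    have hCE : C ≠ E := fun h => hCc (h ▸ hE)
    have hAE : A ≠ E := fun h => hAc (h ▸ hE)
    obtain ⟨m₁, hm₁, hCm₁, hEm₁⟩ := hG.exists_line hCE
    obtain ⟨m₂, hm₂, hAm₂, hEm₂⟩ := hG.exists_line hAE
    -- The plane `ACE` meets `α`, `β`, `γ` only in the transversals `m`, `m₁`, `m₂`, so the three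
    -- conditions say that the segments do not cross `π`.
    obtain ⟨π, hπ, hmπ, hEπ⟩ := hG.exists_plane_of_line hm (fun h => hEα (hmα h))
    have hm₁π := hG.line_subset_plane m₁ π hm₁ hπ C hCm₁ E hEm₁ hCE (hmπ hCm) hEπ
    have hm₂π := hG.line_subset_plane m₂ π hm₂ hπ A hAm₂ E hEm₂ hAE (hmπ hAm) hEπ
    have hm₁β := hG.line_subset_plane m₁ β hm₁ hβ C hCm₁ E hEm₁ hCE (hbβ hC) (hcβ hE)
    have hm₂γ := hG.line_subset_plane m₂ γ hm₂ hγ A hAm₂ E hEm₂ hAE (haγ hA) (hcγ hE)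
    have hπα : ∀ X ∈ π, X ∈ α → X ∈ m := by
      intro X hXπ hXα
      by_contra hX
      have := hG.plane_eq_of_line hm hπ hα hmπ hmα hX hXπ hXα
      exact hEα (this ▸ hEπ)
    have hπβ : ∀ X ∈ π, X ∈ β → X ∈ m₁ := by
      intro X hXπ hXβ
      by_contra hX
      have h1 := hG.plane_eq_of_line hm₁ hπ hβ hm₁π hm₁β hX hXπ hXβ
      have h2 := hG.plane_eq_of_line hb hβ hα hbβ hbα hAb (h1 ▸ hmπ hAm) (haα hA)
      exact hEα (h2 ▸ hcβ hE)
    have hπγ : ∀ X ∈ π, X ∈ γ → X ∈ m₂ := by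
      intro X hXπ hXγ
      by_contra hX
      have h1 := hG.plane_eq_of_line hm₂ hπ hγ hm₂π hm₂γ hX hXπ hXγ
      have h2 := hG.plane_eq_of_line ha hγ hα haγ haα hCa (h1 ▸ hmπ hCm) (hbα hC)
      exact hEα (h2 ▸ hcγ hE)
    refine ⟨A, hA, C, hC, E, hE, fun B hB D hD F hF hAB hCD hEF h1 h2 => ?_⟩
    rw [hG.disjoint_seg_iff hα ha hb haα hbα hab hA hB hAB hC hD hCD hm hAm hCm] at h1
    rw [hG.disjoint_seg_iff hβ hb hc hbβ hcβ hbc hC hD hCD hE hF hEF hm₁ hCm₁ hEm₁] at h2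
    rw [hG.disjoint_seg_iff hγ ha hc haγ hcγ hac hA hB hAB hE hF hEF hm₂ hAm₂ hEm₂]
    rintro ⟨X, hXm₂, hX⟩
    have hBπ : B ∉ π := fun h =>
      hG.notMem_of_transversal ha hm hA hB hAB hAm hCm hCa (hπα B h (haα hB))
    have hDπ : D ∉ π := fun h =>
      hG.notMem_of_transversal hb hm hC hD hCD hCm hAm hAb (hπα D h (hbα hD))
    have hFπ : F ∉ π := fun h =>
      hG.notMem_of_transversal hc hm₂ hE hF hEF hEm₂ hAm₂ hAc (hπγ F h (hcγ hF))
    have hBD : B ≠ D := fun h => Set.disjoint_left.1 hab hB (h ▸ hD)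
    -- If `[BF]` crossed `π`, the plane `BDF` would meet `π` in a line `n` crossed by `[BF]` but by
    -- neither `[BD]` nor `[DF]`, contrary to separation within that plane.
    obtain ⟨p, hp, hBp, hDp⟩ := hG.exists_line hBD
    have hpα := hG.line_subset_plane p α hp hα B hBp D hDp hBD (haα hB) (hbα hD)
    obtain ⟨δ, hδ, hpδ, hFδ⟩ := hG.exists_plane_of_line hp (fun h => hnot F hF (hpα h))
    have hXδ := hG.btw_mem_plane hδ hX (hpδ hBp) hFδ
    obtain ⟨n, hn, hXn, hneq⟩ := hG.exists_line_of_planes hπ hδ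
      (fun h => hBπ (h ▸ hpδ hBp)) (hm₂π hXm₂) hXδ
    have hnπ : n ⊆ π := hneq ▸ Set.inter_subset_left
    have hnδ : n ⊆ δ := hneq ▸ Set.inter_subset_right
    refine hG.crosses_trans hδ hn hnδ (hpδ hBp) (hpδ hDp) hFδ (fun h => hBπ (hnπ h))
      (fun h => hDπ (hnπ h)) (fun h => hFπ (hnπ h)) ?_ ?_ ⟨X, hXn, hX⟩
    · rintro ⟨Y, hYn, hY⟩
      exact h1 ⟨Y, hπα Y (hnπ hYn) (hG.btw_mem_plane hα hY (haα hB) (hbα hD)), hY⟩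
    · rintro ⟨Y, hYn, hY⟩
      exact h2 ⟨Y, hπβ Y (hnπ hYn) (hG.btw_mem_plane hβ hY (hbβ hD) (hcβ hF)), hY⟩

/-! ### Symmetry and transitivity of codirectedness -/

theorem codirected_symm (hG : G.IsEuclidean) {u v : GeomVector P} (h : G.Codirected u v) :
    G.Codirected v u := by
  rcases h with ⟨a, ⟨ha, h1, h2, h3, h4⟩, n, s, hs, i, k, j, q, hi, hk, hj, hq, e1, e2, e3, e4, e⟩
    | ⟨h1, ⟨a, b, ha, hb, h2, h3, h4, h5, h6⟩, h⟩
  · exact Or.inl ⟨a, ⟨ha, h3, h4, h1, h2⟩, n, s, hs, j, q, i, k, hj, hq, hi, hk, e3, e4, e1, e2,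
      e.symm⟩
  · refine Or.inr ⟨fun ⟨c, hc, e1, e2, e3, e4⟩ => h1 ⟨c, hc, e3, e4, e1, e2⟩,
      ⟨b, a, hb, ha, h4, h5, h2, h3, parallel_symm h6⟩, ?_⟩
    rwa [hG.seg_comm v.tgt, hG.seg_comm v.src]

/-- The order of `b` along `v` is carried to `ra` on `a` and `rc` on `c`, making `u` and `w`
positive; `ra` is carried on to `rc'` on `c`. It remains to see that `w` is positive for `rc'` too,
which a test triple on the three lines shows. -/
theorem codirected_trans (hG : G.IsEuclidean) {u v w : GeomVector P} (huv : G.Codirected u v)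
    (hvw : G.Codirected v w) : G.Codirected u w := by
  obtain ⟨a, b, ha, hb, hus, hut, hvs, hvt, hab⟩ := exists_parallel_of_codirected huv
  obtain ⟨b', c, hb', hc, hvs', hvt', hws, hwt, hbc⟩ := exists_parallel_of_codirected hvw
  obtain rfl := hG.line_eq hb hb' v.ne hvs hvt hvs' hvt'
  have hac := hG.parallel_trans ha hb hc hab hbc
  obtain ⟨r, hr, hrv⟩ := hG.exists_orients_rel hb hvs hvt v.ne
  obtain ⟨ra, hra, hba'⟩ := hG.exists_orients_codirected_iff hb ha (parallel_symm hab) hr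
  obtain ⟨rc, hrc, hbc'⟩ := hG.exists_orients_codirected_iff hb hc hbc hr
  obtain ⟨rc', hrc', hac'⟩ := hG.exists_orients_codirected_iff ha hc hac hra
  have hu : ra u.src u.tgt := ((hba' v u hvs hvt hus hut).1 (hG.codirected_symm huv)).1 hrv
  have hw : rc w.src w.tgt := ((hbc' v w hvs hvt hws hwt).1 hvw).1 hrv
  -- When two of the lines coincide, a single order serves both and no third transport has to be
  -- compared.
  by_cases h1 : a = b
  · subst h1
    have := hG.codirected_iff_of_bothOn hr (u := u) (v := v) ⟨ha, hus, hut, hvs, hvt⟩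
    exact (hbc' u w hus hut hws hwt).2 (iff_of_true ((this.1 huv).2 hrv) hw)
  by_cases h2 : b = c
  · subst h2
    have := hG.codirected_iff_of_bothOn hr (u := v) (v := w) ⟨hb, hvs, hvt, hws, hwt⟩
    exact hG.codirected_symm
      ((hba' w u hws hwt hus hut).2 (iff_of_true ((this.1 hvw).1 hrv) hu))
  by_cases h3 : a = c
  · subst h3
    have hvw' := ((hba' v w hvs hvt hws hwt).1 hvw).1 hrv
    exact (hG.codirected_iff_of_bothOn hra ⟨ha, hus, hut, hws, hwt⟩).2 (iff_of_true hu hvw')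
  obtain ⟨⟨α, hα, haα, hbα⟩, dab⟩ := hab.resolve_left h1
  obtain ⟨⟨β, hβ, hbβ, hcβ⟩, dbc⟩ := hbc.resolve_left h2
  obtain ⟨⟨γ, hγ, haγ, hcγ⟩, dac⟩ := hac.resolve_left h3
  obtain ⟨A, hA, C, hC, E, hE, htr⟩ := hG.exists_disjoint_seg_trans ha hb hc hα hβ hγ haα hbα hbβ
    hcβ haγ hcγ dab dbc dac
  obtain ⟨B, hB, hAB⟩ := hG.exists_gt ha hra hA
  obtain ⟨D, hD, hCD⟩ := hG.exists_gt hb hr hC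
  obtain ⟨F, hF, hEF⟩ := hG.exists_gt hc hrc hE
  let x : GeomVector P := ⟨A, B, hra.ne hA hAB⟩
  let y : GeomVector P := ⟨C, D, hr.ne hC hCD⟩
  let z : GeomVector P := ⟨E, F, hrc.ne hE hEF⟩
  have hyx : G.Codirected y x := (hba' y x hC hD hA hB).2 (iff_of_true hCD hAB)
  have hyz : G.Codirected y z := (hbc' y z hC hD hE hF).2 (iff_of_true hCD hEF)
  have hxz : G.Codirected x z := by
    have e1 := (hG.codirected_iff_disjoint_seg ha hb hab h1 hA hB hC hD).1 (hG.codirected_symm hyx)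
    have e2 := (hG.codirected_iff_disjoint_seg hb hc hbc h2 hC hD hE hF).1 hyz
    exact (hG.codirected_iff_disjoint_seg ha hc hac h3 hA hB hE hF).2
      (htr B hB D hD F hF x.ne y.ne z.ne e1 e2)
  -- The test vector `z` is positive for both `rc` and `rc'`. Codirectedness of `z` and `w` can be
  -- read in either order, so `w` is positive for `rc'` as well.
  have hz : rc' E F := ((hac' x z hA hB hE hF).1 hxz).1 hAB
  have hzw : G.Codirected z w :=
    (hG.codirected_iff_of_bothOn hrc ⟨hc, hE, hF, hws, hwt⟩).2 (iff_of_true hEF hw)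
  have hw' : rc' w.src w.tgt :=
    ((hG.codirected_iff_of_bothOn hrc' ⟨hc, hE, hF, hws, hwt⟩).1 hzw).1 hz
  exact (hac' u w hus hut hws hwt).2 (iff_of_true hu hw')

/-! ### Equality of vectors -/

theorem codirected_refl (hG : G.IsEuclidean) (u : GeomVector P) : G.Codirected u u := by
  obtain ⟨a, ha, hs, ht⟩ := hG.exists_line u.ne
  obtain ⟨r, hr⟩ := hG.exists_orients ha
  exact (hG.codirected_iff_of_bothOn hr ⟨ha, hs, ht, hs, ht⟩).2 Iff.rfl

/-- Lay off `[CD]` on the ray from `A` through `B`. By transitivity the resulting `[AX]` is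
congruent to `[AB]`, and uniqueness of laying off gives `X = B`. -/
theorem segCong_symm (hG : G.IsEuclidean) {A B C D : P} (hAB : A ≠ B) (hCD : C ≠ D)
    (h : G.SegCong (G.seg A B) (G.seg C D)) : G.SegCong (G.seg C D) (G.seg A B) := by
  obtain ⟨X, ⟨hX, hXA, hXc⟩, -⟩ := hG.seg_layoff C D A B hCD hAB
  have h1 := hG.seg_trans A B C D A X hAB hCD hXA.symm h hXc
  have h2 : X = B := (hG.seg_layoff A B A B hAB hAB).unique ⟨hX, hXA, h1⟩
    ⟨Or.inr (Or.inl rfl), hAB.symm, hG.seg_refl A B hAB⟩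
  exact h2 ▸ hXc

theorem equivalence_vecEq (hG : G.IsEuclidean) : Equivalence G.VecEq where
  refl u := ⟨hG.codirected_refl u, hG.seg_refl _ _ u.ne⟩
  symm {u v} h := ⟨hG.codirected_symm h.1, hG.segCong_symm u.ne v.ne h.2⟩
  trans {u v w} h h' := ⟨hG.codirected_trans h.1 h'.1,
    hG.seg_trans _ _ _ _ _ _ u.ne v.ne w.ne h.2 h'.2⟩

end IsEuclidean

end SpaceGeometry

/-! ### Free vectors as equivalence classes -/

theorem theorem8p1 {P : Type*} (G : SpaceGeometry P) (hG : G.IsEuclidean) :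
    (∀ u v w : GeomVector P, G.Codirected u v → G.Codirected v w → G.Codirected u w) ∧
    Equivalence G.VecEq ∧
    Setoid.IsPartition G.freeVectors ∧
    ∀ u v : GeomVector P, G.freeVector u = G.freeVector v ↔ G.VecEq u v := by
  have he := hG.equivalence_vecEq
  refine ⟨fun _ _ _ => hG.codirected_trans, he, ?_, fun u v => ⟨fun h => ?_, fun h => ?_⟩⟩
  · have : G.freeVectors = Setoid.classes ⟨G.VecEq, he⟩ := by
      ext s
      constructor
      · rintro ⟨u, rfl⟩
        exact ⟨u, rfl⟩
      · rintro ⟨u, rfl⟩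
        exact ⟨u, rfl⟩
    rw [this]
    exact Setoid.isPartition_classes _
  · have hu : u ∈ G.freeVector u := he.refl u
    rw [h] at hu
    exact hu
  · ext w
    exact ⟨fun hw => he.trans hw h, fun hw => he.trans hw (he.symm h)⟩
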